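/- Let $\eta=\mathrm{diag}(1,-1,-1,-1)$, $p\cdot x=\eta_{\mu\nu}p^\mu x^\nu$, $\square=\eta^{\mu\nu}\partial_\mu\partial_\nu$ on $\mathbb{R}^4$. For $m\ge 0$ let $D_m=D_m^{(+)}+D_m^{(-)}$ be the Pauli--Jordan distribution, with $$D_m^{(\pm)}(x)=\pm\frac{i}{(2\pi)^3}\int dp\; e^{-ip\cdot x}\,\theta(\pm p_0)\,\delta(p^2-m^2),$$ and let derivatives of $D_m$ be split as $(\partial_\mu D_m)^{(\pm)}=\partial_\mu D_m^{(\pm)}$, $(\partial_\mu\partial_\nu D_m)^{(\pm)}=\partial_\mu\partial_\nu D_m^{(\pm)}$. For such $A$, $B$ put $$d(A,B)=A^{(+)}B^{(+)}-A^{(-)}B^{(-)},$$ where a product $uv$ of tempered distributions is the limit in $\mathcal S'$ of $(u*\rho_n)(v*\sigma_n)$, required to exist and to be the same for all delta sequences $(\rho_n)$, $(\sigma_n)$ (i.e. the supports shrink to $\{0\}$, the integrals are $1$, and the $L^1$-norms are bounded). Let $m_1,m_2\ge 0$, $D_j=D_{m_j}$ and $d=d(D_1,D_2)$. If $m_1+m_2>0$,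 let $d'$, $d''$ be the tempered distributions with Fourier transforms $\tilde d'(k)=\tilde d(k)/k^2$ and $\tilde d''(k)=\tilde d(k)/(k^2)^2$. (If $m_1=m_2=0$, then $d'$ and $d''$ occur below only with coefficient $0$, and these terms are omitted.) Then all products of distributions occurring below exist; if $m_1+m_2>0$, then $1/k^2$ is smooth in a neighbourhood of the support of $\tilde d$ and $d'$, $d''$ exist; and for all $\mu,\nu\in\{0,1,2,3\}$ $$d(\partial_\mu D_1,D_2)=\tfrac12\,\partial_\mu\bigl[d+(m_1^2-m_2^2)\,d'\bigr],$$ $$d(D_1,\partial_\mu\partial_\nu D_2)=\tfrac13(\partial_\mu\partial_\nu-\eta_{\mu\nu}\square)\bigl[d-(2m_1^2-m_2^2)\,d'+(m_1^2-m_2^2)^2\,d''\bigr]+\tfrac14\,\eta_{\mu\nu}\square\bigl[d-2(m_1^2-m_2^2)\,d'+(m_1^2-m_2^2)^2\,d''\bigr],$$ $$d(\partial_\mu D_1,\partial_\nu D_2)=\tfrac16(\partial_\mu\partial_\nu-\eta_{\mu\nu}\square)\bigl[d+(m_1^2+m_2^2)\,d'-2(m_1^2-m_2^2)^2\,d''\bigr]+\tfrac14\,\eta_{\mu\nu}\square\bigl[d-(m_1^2-m_2^2)^2\,d''\bigr],$$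 and $$\sum_\mu d(\partial_\mu D_1,\partial^\mu D_2)=\tfrac12\,(\square+m_1^2+m_2^2)\,d,\qquad \partial^\mu=\eta^{\mu\nu}\partial_\nu .$$ -/

import Mathlib

open SchwartzMap MeasureTheory LineDeriv FourierTransform Filter Topology

noncomputable section

namespace CausalDist

/-! ### Minkowski space -/

/-- Minkowski space as a real vector space, with coordinates `x 0, x 1, x 2, x 3` (time first). The
Euclidean norm is only used for its topology, its Lebesgue measure and its Schwartz space. -/
abbrev Mink : Type := EuclideanSpace ℝ (Fin 4)

/-- Complex-valued tempered distributions on Minkowski space. -/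
abbrev TDist : Type := 𝓢'(Mink, ℂ)

/-- The Minkowski metric `diag(1, -1, -1, -1)`; the matrices `η_{μν}` and `η^{μν}` coincide. -/
def eta (μ ν : Fin 4) : ℝ := if μ = ν then (if μ = 0 then 1 else -1) else 0

/-- The Minkowski product `p · x`, for vectors `p`, `x` given by contravariant components. -/
def mdot (p x : Mink) : ℝ := ∑ μ, ∑ ν, eta μ ν * p μ * x ν

lemma mdot_eq (p x : Mink) :
    mdot p x = p 0 * x 0 - p 1 * x 1 - p 2 * x 2 - p 3 * x 3 := by
  simp [mdot, eta, Fin.sum_univ_four]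
  ring

/-- The derivative `∂_μ = ∂/∂x^μ` of tempered distributions. -/
def pd (μ : Fin 4) (u : TDist) : TDist := ∂_{(EuclideanSpace.single μ (1 : ℝ) : Mink)} u

/-- The wave operator `□ = η^{μν} ∂_μ ∂_ν`. -/
def box (u : TDist) : TDist := ∑ μ, ∑ ν, (eta μ ν : ℂ) • pd μ (pd ν u)

/-! ### The Fourier transform with the Minkowski product -/

lemma eta_self_mul_self (μ : Fin 4) : eta μ μ * eta μ μ = 1 := by
  by_cases h : μ = 0 <;> simp [eta, h]

/-- The linear change of variables `p ↦ (2π)⁻¹ (p⁰, -p¹, -p², -p³)`, which turns the phase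
`2π ⟨x, ξ⟩` of Mathlib's Fourier transform into `p · x`. -/
def freq : Mink ≃L[ℝ] Mink :=
  LinearEquiv.toContinuousLinearEquiv
    { toFun := fun p => WithLp.toLp 2 fun μ => (2 * Real.pi)⁻¹ * (eta μ μ * p μ)
      invFun := fun p => WithLp.toLp 2 fun μ => (2 * Real.pi) * (eta μ μ * p μ)
      map_add' := fun p q => by ext μ; simp; ring
      map_smul' := fun c p => by ext μ; simp; ring
      left_inv := fun p => by
        ext μ
        have h := eta_self_mul_self μ
        have hpi := Real.pi_ne_zero
        simp only
        field_simp
        linear_combination p μ * h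
      right_inv := fun p => by
        ext μ
        have h := eta_self_mul_self μ
        have hpi := Real.pi_ne_zero
        simp only
        field_simp
        linear_combination p μ * h }

lemma freq_apply (p : Mink) (μ : Fin 4) : freq p μ = (2 * Real.pi)⁻¹ * (eta μ μ * p μ) := rfl

lemma two_pi_inner_freq (x p : Mink) : 2 * Real.pi * inner ℝ x (freq p) = mdot p x := by
  have hpi := Real.pi_ne_zero
  rw [PiLp.inner_apply, mdot_eq]
  simp [Fin.sum_univ_four, freq_apply, eta]
  field_simp
  ring

/-- `φ ↦ (p ↦ ∫ e^{- i p · x} φ(x) dx)` on Schwartz functions. -/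
def waveMinus : 𝓢(Mink, ℂ) →L[ℂ] 𝓢(Mink, ℂ) :=
  compCLMOfContinuousLinearEquiv ℂ freq ∘L fourierCLM ℂ 𝓢(Mink, ℂ)

/-- `φ ↦ (p ↦ ∫ e^{i p · x} φ(x) dx)` on Schwartz functions. -/
def wavePlus : 𝓢(Mink, ℂ) →L[ℂ] 𝓢(Mink, ℂ) :=
  compCLMOfContinuousLinearEquiv ℂ freq ∘L fourierInvCLM ℂ 𝓢(Mink, ℂ)

lemma waveMinus_apply (φ : 𝓢(Mink, ℂ)) (p : Mink) :
    waveMinus φ p = ∫ x, Complex.exp (-(Complex.I * (mdot p x : ℂ))) * φ x := by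
  have h : waveMinus φ p = 𝓕 (φ : Mink → ℂ) (freq p) := rfl
  rw [h, Real.fourier_eq']
  refine integral_congr_ae (Eventually.of_forall fun x => ?_)
  simp only [smul_eq_mul]
  congr 2
  rw [← two_pi_inner_freq x p]
  push_cast
  ring

lemma wavePlus_apply (φ : 𝓢(Mink, ℂ)) (p : Mink) :
    wavePlus φ p = ∫ x, Complex.exp (Complex.I * (mdot p x : ℂ)) * φ x := by
  have h : wavePlus φ p = 𝓕⁻ (φ : Mink → ℂ) (freq p) := by
    rw [← SchwartzMap.fourierInv_coe]; rfl
  rw [h, Real.fourierInv_eq']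
  refine integral_congr_ae (Eventually.of_forall fun x => ?_)
  simp only [smul_eq_mul]
  congr 2
  rw [← two_pi_inner_freq x p]
  push_cast
  ring

/-- The Fourier transform `ũ(k) = (2π)⁻² ∫ e^{i k · x} u(x) dx` of tempered distributions. -/
def fourierM (u : TDist) : TDist :=
  (((2 * Real.pi) ^ 2)⁻¹ : ℂ) • PointwiseConvergenceCLM.precomp ℂ wavePlus u

/-! ### The Pauli-Jordan distribution -/

/-- The energy `√(m² + |p|²)`. -/
def energy (m : ℝ) (p : EuclideanSpace ℝ (Fin 3)) : ℝ := Real.sqrt (m ^ 2 + ‖p‖ ^ 2)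

/-- The point `(s ω(p), p)` of the mass shell, for `s = ± 1`. -/
def shellPoint (m : ℝ) (s : ℤˣ) (p : EuclideanSpace ℝ (Fin 3)) : Mink :=
  WithLp.toLp 2 (Fin.cons (((s : ℤ) : ℝ) * energy m p) p.ofLp)

/-- The measure `θ(s p₀) δ(p² - m²) dp` for `s = ± 1`: the image of `d³p / (2 ω(p))` under
`p ↦ (s ω(p), p)`. -/
def shell (m : ℝ) (s : ℤˣ) : Measure Mink :=
  Measure.map (shellPoint m s)
    (volume.withDensity fun p => ENNReal.ofReal (2 * energy m p)⁻¹)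

lemma continuous_energy (m : ℝ) : Continuous (energy m) := by
  unfold energy; fun_prop

lemma continuous_shellPoint (m : ℝ) (s : ℤˣ) : Continuous (shellPoint m s) := by
  unfold shellPoint
  refine (PiLp.continuous_toLp 2 _).comp (continuous_pi fun i => ?_)
  refine Fin.cases ?_ (fun j => ?_) i
  · exact continuous_const.mul (continuous_energy m)
  · simp only [Fin.cons_succ]; fun_prop

lemma norm_le_norm_shellPoint (m : ℝ) (s : ℤˣ) (p : EuclideanSpace ℝ (Fin 3)) :
    ‖p‖ ≤ ‖shellPoint m s p‖ := by
  rw [EuclideanSpace.norm_eq, EuclideanSpace.norm_eq]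
  refine Real.sqrt_le_sqrt ?_
  rw [Fin.sum_univ_succ (n := 3)]
  simp only [shellPoint, Fin.cons_zero, Fin.cons_succ]
  nlinarith [sq_nonneg ‖((s : ℤ) : ℝ) * energy m p‖]

instance instTemperateShell (m : ℝ) (s : ℤˣ) : (shell m s).HasTemperateGrowth := by
  refine ⟨⟨4, ?_⟩⟩
  have hmeas : Measurable fun p : EuclideanSpace ℝ (Fin 3) => (2 * energy m p)⁻¹ :=
    ((continuous_energy m).measurable.const_mul 2).inv
  have hc : Continuous fun x : Mink => (1 + ‖x‖) ^ (-((4 : ℕ) : ℝ)) :=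
    (continuous_const.add continuous_norm).rpow_const
      fun x => Or.inl (ne_of_gt (add_pos_of_pos_of_nonneg one_pos (norm_nonneg x)))
  unfold shell
  rw [integrable_map_measure hc.aestronglyMeasurable
    (continuous_shellPoint m s).measurable.aemeasurable]
  have hnn : ∀ p, 0 ≤ (2 * energy m p)⁻¹ := fun p => by unfold energy; positivity
  rw [integrable_withDensity_iff_integrable_smul' hmeas.ennreal_ofReal
    (Eventually.of_forall fun p => ENNReal.ofReal_lt_top)]
  have key : Integrable
      (fun p : EuclideanSpace ℝ (Fin 3) => ‖p‖⁻¹ * (1 + ‖p‖) ^ (-(4 : ℝ))) volume := by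
    rw [integrable_fun_norm_addHaar volume (f := fun r : ℝ => r⁻¹ * (1 + r) ^ (-(4 : ℝ)))]
    have h2 : IntegrableOn (fun r : ℝ => (1 + ‖r‖) ^ (-(2 : ℝ))) (Set.Ioi 0) volume :=
      (integrable_one_add_norm (by simp)).integrableOn
    refine Integrable.mono' h2 ?_ ?_
    · refine (Measurable.aestronglyMeasurable ?_)
      fun_prop
    · refine (ae_restrict_iff' measurableSet_Ioi).2 (Eventually.of_forall fun r hr => ?_)
      have hr : (0 : ℝ) < r := hr
      have h1 : (0 : ℝ) < 1 + r := by linarith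
      have e4 : (1 + r) ^ (-(4 : ℝ)) = ((1 + r) ^ 4)⁻¹ := by
        rw [Real.rpow_neg h1.le]; norm_cast
      have e2 : (1 + r) ^ (-(2 : ℝ)) = ((1 + r) ^ 2)⁻¹ := by
        rw [Real.rpow_neg h1.le]; norm_cast
      simp only [finrank_euclideanSpace, Fintype.card_fin, smul_eq_mul]
      rw [Real.norm_of_nonneg (by positivity), Real.norm_of_nonneg hr.le, e4, e2]
      rw [show r ^ (3 - 1) * (r⁻¹ * ((1 + r) ^ 4)⁻¹) = r / (1 + r) ^ 4 by field_simp]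
      rw [div_le_iff₀ (by positivity),
        show ((1 + r) ^ 2)⁻¹ * (1 + r) ^ 4 = (1 + r) ^ 2 by field_simp]
      nlinarith
  refine key.mono' ?_ ?_
  · refine AEStronglyMeasurable.fun_smul ?_ ?_
    · exact hmeas.ennreal_ofReal.ennreal_toReal.aestronglyMeasurable
    · exact (hc.comp (continuous_shellPoint m s)).aestronglyMeasurable
  · filter_upwards [Measure.ae_ne volume (0 : EuclideanSpace ℝ (Fin 3))] with p hp
    have hp0 : 0 < ‖p‖ := norm_pos_iff.2 hp
    rw [ENNReal.toReal_ofReal (hnn p), smul_eq_mul, norm_mul, Real.norm_of_nonneg (hnn p)]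
    have hle := norm_le_norm_shellPoint m s p
    have hω : ‖p‖ ≤ energy m p := Real.le_sqrt_of_sq_le (by nlinarith [sq_nonneg m])
    refine mul_le_mul ?_ ?_ (norm_nonneg _) (by positivity)
    · exact inv_anti₀ hp0 (by linarith)
    · simp only [Function.comp]
      rw [Real.norm_of_nonneg (by positivity)]
      have := Real.rpow_le_rpow_of_nonpos (x := 1 + ‖p‖) (y := 1 + ‖shellPoint m s p‖)
        (z := -((4 : ℕ) : ℝ)) (by positivity) (by linarith) (by norm_num)
      simpa using this

/-- A distribution `D` given with its positive frequency part `D 1 = D^{(+)}` and its negative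
frequency part `D (-1) = D^{(-)}`. -/
abbrev Split : Type := ℤˣ → TDist

/-- The Pauli-Jordan distribution of mass `m`, through its frequency parts
`D_m^{(±)}(x) = ± i (2π)⁻³ ∫ e^{- i p · x} θ(± p₀) δ(p² - m²) dp`. -/
def pauliJordan (m : ℝ) : Split := fun s =>
  (((s : ℤ) : ℂ) * Complex.I / (2 * Real.pi) ^ 3) •
    PointwiseConvergenceCLM.precomp ℂ waveMinus (shell m s).toTemperedDistribution

lemma pauliJordan_apply (m : ℝ) (s : ℤˣ) (φ : 𝓢(Mink, ℂ)) :
    pauliJordan m s φ = ((s : ℤ) : ℂ) * Complex.I / (2 * Real.pi) ^ 3 *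
      ∫ p, (∫ x, Complex.exp (-(Complex.I * (mdot p x : ℂ))) * φ x) ∂(shell m s) := by
  simp only [← waveMinus_apply]
  rfl

/-- The derivative `∂_μ D`, with frequency parts `∂_μ D^{(±)}`. -/
def Split.deriv (μ : Fin 4) (D : Split) : Split := fun s => pd μ (D s)

/-- The derivative `∂^μ D = η^{μν} ∂_ν D`. -/
def Split.derivUp (μ : Fin 4) (D : Split) : Split := fun s => ∑ ν, (eta μ ν : ℂ) • pd ν (D s)

/-! ### Products of distributions -/

/-- `ρ` is a delta sequence: the supports shrink to `{0}`, the integrals are `1`, and the `L¹` norms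
are bounded. -/
structure IsDeltaSeq (ρ : ℕ → 𝓢(Mink, ℂ)) : Prop where
  support_shrinks : ∀ r > 0, ∀ᶠ n in atTop, tsupport (ρ n) ⊆ Metric.closedBall 0 r
  integral_eq_one : ∀ n, ∫ x, ρ n x = 1
  bounded : ∃ C : ℝ, ∀ n, ∫ x, ‖ρ n x‖ ≤ C

/-- The test function `y ↦ ρ(x - y)`. -/
def reflectAt (ρ : 𝓢(Mink, ℂ)) (x : Mink) : 𝓢(Mink, ℂ) :=
  compSubConstCLM ℂ x (compCLMOfContinuousLinearEquiv ℂ (ContinuousLinearEquiv.neg ℝ) ρ)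

lemma reflectAt_apply (ρ : 𝓢(Mink, ℂ)) (x y : Mink) : reflectAt ρ x y = ρ (x - y) := by
  simp [reflectAt]

/-- The convolution `u * ρ`, a smooth function of polynomial growth. -/
def mollify (u : TDist) (ρ : 𝓢(Mink, ℂ)) (x : Mink) : ℂ := u (reflectAt ρ x)

/-- `w` is the product of the tempered distributions `u` and `v`: the regularized products
`(u * ρₙ) (v * σₙ)` converge to `w`, for all delta sequences `ρ`, `σ`. -/
def IsProd (u v w : TDist) : Prop :=
  ∀ ρ σ : ℕ → 𝓢(Mink, ℂ), IsDeltaSeq ρ → IsDeltaSeq σ → ∀ φ : 𝓢(Mink, ℂ),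
    Tendsto (fun n => ∫ x, mollify u (ρ n) x * mollify v (σ n) x * φ x) atTop (𝓝 (w φ))

lemma exists_isDeltaSeq : ∃ ρ : ℕ → 𝓢(Mink, ℂ), IsDeltaSeq ρ := by
  let b : ℕ → ContDiffBump (0 : Mink) := fun n =>
    ⟨1 / ((n : ℝ) + 2), 1 / ((n : ℝ) + 1), by positivity,
      one_div_lt_one_div_of_lt (by positivity) (by linarith)⟩
  have hc : ∀ n, HasCompactSupport (Complex.ofRealCLM ∘ (b n).normed volume) := fun n =>
    ((b n).hasCompactSupport_normed (μ := volume)).comp_left rfl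
  have hs : ∀ n, ContDiff ℝ ((⊤ : ℕ∞) : WithTop ℕ∞)
      (Complex.ofRealCLM ∘ (b n).normed volume) := fun n =>
    Complex.ofRealCLM.contDiff.comp (b n).contDiff_normed
  refine ⟨fun n => (hc n).toSchwartzMap (hs n), ?_, ?_, 1, ?_⟩
  · intro r hr
    have h1 : ∀ᶠ n : ℕ in atTop, 1 / ((n : ℝ) + 1) < r :=
      (tendsto_order.1 tendsto_one_div_add_atTop_nhds_zero_nat).2 r hr
    filter_upwards [h1] with n hn
    refine (tsupport_comp_subset (g := Complex.ofRealCLM) rfl ((b n).normed volume)).trans ?_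
    rw [(b n).tsupport_normed_eq]
    exact Metric.closedBall_subset_closedBall hn.le
  · intro n
    have h : ∀ x, (hc n).toSchwartzMap (hs n) x = (((b n).normed volume x : ℝ) : ℂ) :=
      fun x => rfl
    simp only [h]
    rw [integral_complex_ofReal, (b n).integral_normed]
    simp
  · intro n
    have h : ∀ x, ‖(hc n).toSchwartzMap (hs n) x‖ = (b n).normed volume x := fun x => by
      change ‖(((b n).normed volume x : ℝ) : ℂ)‖ = _
      rw [Complex.norm_real, Real.norm_of_nonneg ((b n).nonneg_normed x)]
    simp only [h]
    exact (b n).integral_normed.le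

lemma IsProd.unique {u v w w' : TDist} (h : IsProd u v w) (h' : IsProd u v w') : w = w' := by
  obtain ⟨ρ, hρ⟩ := exists_isDeltaSeq
  ext φ
  exact tendsto_nhds_unique (h ρ ρ hρ hρ φ) (h' ρ ρ hρ hρ φ)

/-- The product of `u` and `v` exists. -/
def HasProd (u v : TDist) : Prop := ∃ w, IsProd u v w

open Classical in
/-- The product of `u` and `v` (zero if it does not exist). -/
def distMul (u v : TDist) : TDist := if h : HasProd u v then h.choose else 0

/-- Both products that enter `d(A, B)` exist. -/
def HasCausal (A B : Split) : Prop := HasProd (A 1) (B 1) ∧ HasProd (A (-1)) (B (-1))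

/-- `d(A, B) = A^{(+)} B^{(+)} - A^{(-)} B^{(-)}`. -/
def causal (A B : Split) : TDist := distMul (A 1) (B 1) - distMul (A (-1)) (B (-1))

/-! ### Division by powers of `k²` in momentum space -/

/-- `w̃(k) = ũ(k) / (k²)ⁿ`, where `(k²)⁻ⁿ` is smooth near the support of `ũ`: there are an open set
`U` off which `ũ` vanishes, and a smooth function `χ` of temperate growth with `χ(k) = (k²)⁻ⁿ` for
`k ∈ U` (where `k² ≠ 0`), such that `w̃ = χ ũ`. -/
def IsDivKSq (n : ℕ) (u w : TDist) : Prop :=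
  ∃ (U : Set Mink) (χ : Mink → ℂ), IsOpen U ∧ Distribution.IsVanishingOn (fourierM u) Uᶜ ∧
    χ.HasTemperateGrowth ∧ (∀ k ∈ U, χ k * (mdot k k : ℂ) ^ n = 1) ∧
    fourierM w = TemperedDistribution.smulLeftCLM ℂ χ (fourierM u)

lemma fourierM_injective : Function.Injective fourierM := by
  intro u v h
  have hc : (((2 * Real.pi) ^ 2)⁻¹ : ℂ) ≠ 0 := by
    have := Real.pi_ne_zero
    simp [this]
  have h1 := smul_right_injective TDist hc h
  ext φ
  obtain ⟨ψ, rfl⟩ : ∃ ψ, wavePlus ψ = φ := by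
    refine ⟨𝓕 (compCLMOfContinuousLinearEquiv ℂ freq.symm φ : 𝓢(Mink, ℂ)), ?_⟩
    change compCLMOfContinuousLinearEquiv ℂ freq
      (𝓕⁻ (𝓕 (compCLMOfContinuousLinearEquiv ℂ freq.symm φ : 𝓢(Mink, ℂ)))) = φ
    rw [FourierTransform.fourierInv_fourier_eq]
    ext x
    simp
  exact congrArg (fun w : TDist => w ψ) h1

lemma temperate_mdot_pow (n : ℕ) :
    (fun k : Mink => (mdot k k : ℂ) ^ n).HasTemperateGrowth := by
  have h : ∀ i : Fin 4, (fun k : Mink => ((k i : ℝ) : ℂ)).HasTemperateGrowth := fun i =>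
    (Complex.ofRealCLM ∘L
      (EuclideanSpace.proj i : EuclideanSpace ℝ (Fin 4) →L[ℝ] ℝ)).hasTemperateGrowth
  have h0 := h 0
  have h1 := h 1
  have h2 := h 2
  have h3 := h 3
  simp only [mdot_eq]
  push_cast
  fun_prop

lemma IsDivKSq.eq_aux {n : ℕ} {f : TDist} {U : Set Mink} {χ : Mink → ℂ} (hU : IsOpen U)
    (hf : Distribution.IsVanishingOn f Uᶜ) (hχ : χ.HasTemperateGrowth)
    (h : ∀ k ∈ U, χ k * (mdot k k : ℂ) ^ n = 1) :
    TemperedDistribution.smulLeftCLM ℂ (χ * fun k => (mdot k k : ℂ) ^ n) f = f := by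
  have hq := temperate_mdot_pow n
  ext φ
  rw [← sub_eq_zero, TemperedDistribution.smulLeftCLM_apply_apply, ← map_sub]
  refine hf _ (closure_minimal (fun x hx hxU => hx ?_) hU.isClosed_compl)
  rw [sub_apply, SchwartzMap.smulLeftCLM_apply_apply (hχ.mul hq)]
  simp [h x hxU]

lemma IsDivKSq.unique {n : ℕ} {u w w' : TDist} (h : IsDivKSq n u w) (h' : IsDivKSq n u w') :
    w = w' := by
  obtain ⟨U, χ, hU, hv, hχ, h1, hw⟩ := h
  obtain ⟨U', χ', hU', hv', hχ', h1', hw'⟩ := h'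
  have hq := temperate_mdot_pow n
  have e := eq_aux hU hv hχ h1
  have e' := eq_aux hU' hv' hχ' h1'
  apply fourierM_injective
  rw [hw, hw']
  conv_lhs => rw [← e']
  conv_rhs => rw [← e]
  rw [TemperedDistribution.smulLeftCLM_smulLeftCLM_apply (hχ'.mul hq) hχ,
    TemperedDistribution.smulLeftCLM_smulLeftCLM_apply (hχ.mul hq) hχ']
  congr 2
  ring

/-- `ũ(k) / (k²)ⁿ` makes sense. -/
def HasDivKSq (n : ℕ) (u : TDist) : Prop := ∃ w, IsDivKSq n u w

open Classical in
/-- The distribution with Fourier transform `ũ(k) / (k²)ⁿ` (zero if this makes no sense). -/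
def divKSq (n : ℕ) (u : TDist) : TDist := if h : HasDivKSq n u then h.choose else 0

/-! ### The tensor operator of the decompositions -/

/-- The differential operator `∂_μ ∂_ν - η_{μν} □`. -/
def transOp (μ ν : Fin 4) (u : TDist) : TDist := pd μ (pd ν u) - (eta μ ν : ℂ) • box u

end CausalDist

end

open CausalDist

/-!
In momentum space, `D_m^{(±)}` is a multiple of the invariant measure on one sheet of the mass
shell. For two momenta `p`, `q` on sheets of the same sign the energies add up, so that the total
momentum `k = p + q` controls both of them (`energy_add_le_norm`). Hence the convolution of two such
measures exists, also after multiplication by polynomials. The Fourier transforms of a delta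
sequence are bounded and tend to `1`, so by dominated convergence it is the Fourier transform of the
product of the distributions (`isProd_shellWave`). Every distribution in the theorem then has the
form `φ ↦ c² (I⁺ - I⁻)`, where `I^±` is the integral of `P(p, q) φ̂(p + q)` over pairs of momenta
(`IsPairWave`). A derivative acts as `-i k_μ`. If `m₁ + m₂ > 0`, then `k² ≥ (m₁ + m₂)²`, and division
by `k²` is multiplication by a function of `k` that is smooth near the support.

The identities thus say that certain amplitudes `P` have mean zero at fixed `k` (`IsNull`): the mean
of `p` is `k (k · p) / k²`, and the mean of `p^μ p^ν` is the Lorentz covariant expression in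
`k^μ k^ν` and `η^{μν}` that has the right trace and contraction with `k`. Both `p²` and
`k · p = (k² + m₁² - m₂²) / 2` are constant at fixed `k`.

The invariance behind this is used infinitesimally. At fixed spatial part of `k` the gradient of
the total energy with respect to the spatial momentum is `v = p / ω₁ - q / ω₂`, and
`ω₁ ω₂ v^j = ± (k⁰ p^j - k^j p⁰)`. The curl of `h(k) G v` contains neither derivatives of `h` nor
of `v`, and it integrates to zero. This is `isNull_curl`; for `G` a coordinate of `p` or a product of
two coordinates it yields that `k⁰ p^j - k^j p⁰` is null and that `p^l (k⁰ p^j - k^j p⁰)` has an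
isotropic mean. The moments follow by algebra (`isNull_firstMoment`, `isNull_secondMoment`), up to
factors that are functions of `k`, positive almost everywhere, which can be cancelled
(`IsNull.of_mul_total`). The integration by parts needs positive masses; the massless cases are
limits (`IsNull.of_tendsto`).
-/

open SchwartzMap MeasureTheory LineDeriv FourierTransform Filter Topology

noncomputable section

namespace CausalDist

/-! ### The mass shell in momentum coordinates -/

/-- Momentum space: the spatial momenta. -/
abbrev E3 : Type := EuclideanSpace ℝ (Fin 3)

/-- The density `1 / (2 ω(p))` of the shell measure in the coordinates `p`. -/
def weight (m : ℝ) (p : E3) : ℝ := (2 * energy m p)⁻¹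

lemma energy_nonneg (m : ℝ) (p : E3) : 0 ≤ energy m p := Real.sqrt_nonneg _

lemma energy_sq (m : ℝ) (p : E3) : energy m p ^ 2 = m ^ 2 + ‖p‖ ^ 2 :=
  Real.sq_sqrt (by positivity)

lemma norm_le_energy (m : ℝ) (p : E3) : ‖p‖ ≤ energy m p :=
  Real.le_sqrt_of_sq_le (by nlinarith [sq_nonneg m])

lemma energy_pos {m : ℝ} (hm : 0 < m) (p : E3) : 0 < energy m p :=
  Real.sqrt_pos.2 (by positivity)

lemma norm_sq_eq (p : E3) : ‖p‖ ^ 2 = p 0 ^ 2 + p 1 ^ 2 + p 2 ^ 2 := by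
  rw [EuclideanSpace.norm_sq_eq]; simp [Fin.sum_univ_three]

lemma weight_nonneg (m : ℝ) (p : E3) : 0 ≤ weight m p := by
  have := energy_nonneg m p
  unfold weight; positivity

lemma measurable_weight (m : ℝ) : Measurable (weight m) :=
  ((continuous_energy m).measurable.const_mul 2).inv

@[simp] lemma shellPoint_zero (m : ℝ) (s : ℤˣ) (p : E3) :
    shellPoint m s p 0 = ((s : ℤ) : ℝ) * energy m p := rfl

@[simp] lemma shellPoint_succ (m : ℝ) (s : ℤˣ) (p : E3) (i : Fin 3) :
    shellPoint m s p i.succ = p i := rfl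

lemma sign_sq (s : ℤˣ) : ((s : ℤ) : ℝ) ^ 2 = 1 := by
  rcases Int.units_eq_one_or s with rfl | rfl <;> simp

lemma sign_sq_complex (s : ℤˣ) : ((s : ℤ) : ℂ) ^ 2 = 1 := by
  rcases Int.units_eq_one_or s with rfl | rfl <;> simp

lemma norm_sq_mink (x : Mink) : ‖x‖ ^ 2 = x 0 ^ 2 + ∑ i : Fin 3, x i.succ ^ 2 := by
  rw [EuclideanSpace.norm_sq_eq, Fin.sum_univ_succ]; simp

lemma norm_shellPoint_le (m : ℝ) (s : ℤˣ) (p : E3) :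
    ‖shellPoint m s p‖ ≤ 2 * energy m p := by
  have h := norm_sq_mink (shellPoint m s p)
  simp only [shellPoint_zero, shellPoint_succ, mul_pow, sign_sq] at h
  have h2 : ∑ i : Fin 3, p i ^ 2 = ‖p‖ ^ 2 := by rw [EuclideanSpace.norm_sq_eq]; simp
  have h3 := norm_le_energy m p
  have h4 := norm_nonneg p
  refine le_of_sq_le_sq (by nlinarith) (by linarith)
 
/-- The energies of two momenta of the same cone add up, so that there is no cancellation in the
total momentum. -/
lemma energy_add_le_norm (m₁ m₂ : ℝ) (s : ℤˣ) (p q : E3) :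
    energy m₁ p + energy m₂ q ≤ ‖shellPoint m₁ s p + shellPoint m₂ s q‖ := by
  have h := norm_sq_mink (shellPoint m₁ s p + shellPoint m₂ s q)
  simp only [PiLp.add_apply, shellPoint_zero, shellPoint_succ, ← mul_add, mul_pow, sign_sq] at h
  have h1 : 0 ≤ ∑ i : Fin 3, (p i + q i) ^ 2 := Finset.sum_nonneg fun i _ => sq_nonneg _
  exact le_of_sq_le_sq (by linarith) (norm_nonneg _)

lemma integral_shell (m : ℝ) (s : ℤˣ) {F : Mink → ℂ} (hF : Continuous F) :
    ∫ P, F P ∂(shell m s) = ∫ p : E3, (weight m p : ℂ) * F (shellPoint m s p) := by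
  unfold shell
  rw [integral_map (continuous_shellPoint m s).measurable.aemeasurable
    hF.aestronglyMeasurable]
  change ∫ p : E3, F (shellPoint m s p) ∂(volume.withDensity
    fun p => ENNReal.ofReal (weight m p)) = _
  rw [integral_withDensity_eq_integral_toReal_smul
      (measurable_weight m).ennreal_ofReal (Eventually.of_forall fun _ => ENNReal.ofReal_lt_top)]
  refine integral_congr_ae (Eventually.of_forall fun p => ?_)
  change (ENNReal.ofReal (weight m p)).toReal • F (shellPoint m s p) = _
  rw [ENNReal.toReal_ofReal (weight_nonneg m p), Complex.real_smul]

/-- An integrable majorant for the integrals over one mass shell, independent of the mass. -/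
def majorant (p : E3) : ℝ := ‖p‖⁻¹ * ((1 + ‖p‖) ^ 4)⁻¹

lemma integrable_majorant : Integrable majorant := by
  unfold majorant
  rw [integrable_fun_norm_addHaar volume (f := fun r : ℝ => r⁻¹ * ((1 + r) ^ 4)⁻¹)]
  have h2 : IntegrableOn (fun r : ℝ => (1 + ‖r‖) ^ (-(2 : ℝ))) (Set.Ioi 0) volume :=
    (integrable_one_add_norm (by simp)).integrableOn
  refine Integrable.mono' h2 (Measurable.aestronglyMeasurable (by fun_prop)) ?_
  refine (ae_restrict_iff' measurableSet_Ioi).2 (Eventually.of_forall fun r hr => ?_)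
  have hr : (0 : ℝ) < r := hr
  have h1 : (0 : ℝ) < 1 + r := by linarith
  have e2 : (1 + r) ^ (-(2 : ℝ)) = ((1 + r) ^ 2)⁻¹ := by
    rw [Real.rpow_neg h1.le]; norm_cast
  simp only [finrank_euclideanSpace, Fintype.card_fin, smul_eq_mul]
  rw [Real.norm_of_nonneg (by positivity), Real.norm_of_nonneg hr.le, e2]
  rw [show r ^ (3 - 1) * (r⁻¹ * ((1 + r) ^ 4)⁻¹) = r / (1 + r) ^ 4 by field_simp]
  rw [div_le_iff₀ (by positivity),
    show ((1 + r) ^ 2)⁻¹ * (1 + r) ^ 4 = (1 + r) ^ 2 by field_simp]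
  nlinarith

lemma weight_le (m : ℝ) {p : E3} (hp : p ≠ 0) : weight m p ≤ ‖p‖⁻¹ := by
  have h0 : 0 < ‖p‖ := norm_pos_iff.2 hp
  have := norm_le_energy m p
  exact inv_anti₀ h0 (by linarith)

/-! ### Two-particle integrals -/

/-- The momenta `(p, q)` of a pair of particles, as a function of the spatial momenta. -/
def pairPoint (m₁ m₂ : ℝ) (s : ℤˣ) (z : E3 × E3) : Mink × Mink :=
  (shellPoint m₁ s z.1, shellPoint m₂ s z.2)

lemma continuous_pairPoint (m₁ m₂ : ℝ) (s : ℤˣ) : Continuous (pairPoint m₁ m₂ s) :=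
  ((continuous_shellPoint m₁ s).comp continuous_fst).prodMk
    ((continuous_shellPoint m₂ s).comp continuous_snd)

/-- The density of the product of two shell measures. -/
def pairWeight (m₁ m₂ : ℝ) (z : E3 × E3) : ℝ := weight m₁ z.1 * weight m₂ z.2

lemma measurable_pairWeight (m₁ m₂ : ℝ) : Measurable (pairWeight m₁ m₂) :=
  ((measurable_weight m₁).comp measurable_fst).mul ((measurable_weight m₂).comp measurable_snd)

lemma pairWeight_nonneg (m₁ m₂ : ℝ) (z : E3 × E3) : 0 ≤ pairWeight m₁ m₂ z :=
  mul_nonneg (weight_nonneg _ _) (weight_nonneg _ _)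

/-- The integrand `h(p + q) P(p, q)` of a two-particle integral, with its density. -/
def pairFun (m₁ m₂ : ℝ) (s : ℤˣ) (P : Mink × Mink → ℂ) (h : Mink → ℂ) (z : E3 × E3) : ℂ :=
  (pairWeight m₁ m₂ z : ℂ) *
    (h ((pairPoint m₁ m₂ s z).1 + (pairPoint m₁ m₂ s z).2) * P (pairPoint m₁ m₂ s z))

/-- An integrable majorant for two-particle integrals. -/
def pairMajorant (z : E3 × E3) : ℝ := majorant z.1 * majorant z.2

lemma integrable_pairMajorant : Integrable pairMajorant :=
  integrable_majorant.mul_prod integrable_majorant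

lemma ae_ne_zero : ∀ᵐ z : E3 × E3, z.1 ≠ 0 ∧ z.2 ≠ 0 := by
  have h : ∀ᵐ p : E3, p ≠ 0 := Measure.ae_ne volume 0
  exact (Measure.quasiMeasurePreserving_fst.ae h).and (Measure.quasiMeasurePreserving_snd.ae h)

lemma pairWeight_le (m₁ m₂ : ℝ) {z : E3 × E3} (h1 : z.1 ≠ 0) (h2 : z.2 ≠ 0) :
    pairWeight m₁ m₂ z * (((1 + ‖z.1‖) ^ 4)⁻¹ * ((1 + ‖z.2‖) ^ 4)⁻¹) ≤ pairMajorant z := by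
  have e : pairMajorant z = (‖z.1‖⁻¹ * ‖z.2‖⁻¹) *
      (((1 + ‖z.1‖) ^ 4)⁻¹ * ((1 + ‖z.2‖) ^ 4)⁻¹) := by
    unfold pairMajorant majorant; ring
  rw [e]
  refine mul_le_mul_of_nonneg_right ?_ (by positivity)
  exact mul_le_mul (weight_le m₁ h1) (weight_le m₂ h2) (weight_nonneg _ _) (by positivity)

/-- The bound that makes two-particle integrals converge: a Schwartz function of the total momentum
decays in both momenta, uniformly in the masses, since these lie in the same cone. -/
lemma exists_bound_pair {P : Mink × Mink → ℂ} (hP : P.HasTemperateGrowth) :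
    ∃ (C : ℝ) (n : ℕ × ℕ), 0 ≤ C ∧ ∀ (h : 𝓢(Mink, ℂ)) (m₁ m₂ : ℝ) (s : ℤˣ) (z : E3 × E3),
      ‖h ((pairPoint m₁ m₂ s z).1 + (pairPoint m₁ m₂ s z).2) * P (pairPoint m₁ m₂ s z)‖ ≤
        C * (Finset.Iic n).sup (schwartzSeminormFamily ℂ Mink ℂ) h *
          (((1 + ‖z.1‖) ^ 4)⁻¹ * ((1 + ‖z.2‖) ^ 4)⁻¹) := by
  obtain ⟨N, C, hC, hb⟩ := hP.norm_iteratedFDeriv_le_uniform 0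
  refine ⟨C * 2 ^ N * 2 ^ (N + 8), (N + 8, 0), by positivity, fun h m₁ m₂ s z => ?_⟩
  set k := (pairPoint m₁ m₂ s z).1 + (pairPoint m₁ m₂ s z).2 with hk
  have hkn : energy m₁ z.1 + energy m₂ z.2 ≤ ‖k‖ := energy_add_le_norm m₁ m₂ s z.1 z.2
  have e1 := energy_nonneg m₁ z.1
  have e2 := energy_nonneg m₂ z.2
  have n1 := norm_le_energy m₁ z.1
  have n2 := norm_le_energy m₂ z.2
  have hPn : ‖P (pairPoint m₁ m₂ s z)‖ ≤ C * (2 ^ N * (1 + ‖k‖) ^ N) := by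
    have := hb 0 le_rfl (pairPoint m₁ m₂ s z)
    rw [norm_iteratedFDeriv_zero] at this
    refine this.trans (mul_le_mul_of_nonneg_left ?_ hC)
    rw [← mul_pow]
    refine pow_le_pow_left₀ (by positivity) ?_ N
    have : ‖pairPoint m₁ m₂ s z‖ ≤ 2 * ‖k‖ := by
      refine max_le ?_ ?_
      · exact (norm_shellPoint_le m₁ s z.1).trans (by linarith)
      · exact (norm_shellPoint_le m₂ s z.2).trans (by linarith)
    linarith
  have hh := SchwartzMap.one_add_le_sup_seminorm_apply (𝕜 := ℂ) (m := (N + 8, 0)) le_rfl le_rfl h k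
  rw [norm_iteratedFDeriv_zero] at hh
  change _ ≤ _ * (Finset.Iic (N + 8, 0)).sup (schwartzSeminormFamily ℂ Mink ℂ) h at hh
  set S := (Finset.Iic (N + 8, 0)).sup (schwartzSeminormFamily ℂ Mink ℂ) h with hS
  have h8 : (1 + ‖z.1‖) ^ 4 * (1 + ‖z.2‖) ^ 4 ≤ (1 + ‖k‖) ^ 8 := by
    rw [show (1 + ‖k‖) ^ 8 = (1 + ‖k‖) ^ 4 * (1 + ‖k‖) ^ 4 by ring]
    gcongr <;> linarith
  have hk0 : 0 < 1 + ‖k‖ := by positivity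
  rw [norm_mul, ← mul_inv, ← div_eq_mul_inv, le_div_iff₀ (by positivity)]
  calc ‖h k‖ * ‖P (pairPoint m₁ m₂ s z)‖ * ((1 + ‖z.1‖) ^ 4 * (1 + ‖z.2‖) ^ 4)
      ≤ ‖h k‖ * (C * (2 ^ N * (1 + ‖k‖) ^ N)) * (1 + ‖k‖) ^ 8 := by gcongr
    _ = C * 2 ^ N * ((1 + ‖k‖) ^ (N + 8) * ‖h k‖) := by ring
    _ ≤ C * 2 ^ N * (2 ^ (N + 8) * S) := by gcongr
    _ = _ := by ring

/-- A majorant of the integrands of two-particle integrals, with the same constant for all masses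
and both signs. -/
lemma exists_majorant_pairFun {P : Mink × Mink → ℂ} (hP : P.HasTemperateGrowth) :
    ∃ (C : ℝ) (n : ℕ × ℕ), 0 ≤ C ∧ ∀ (h : 𝓢(Mink, ℂ)) (m₁ m₂ : ℝ) (s : ℤˣ),
      ∀ᵐ z, ‖pairFun m₁ m₂ s P h z‖ ≤
        C * (Finset.Iic n).sup (schwartzSeminormFamily ℂ Mink ℂ) h * pairMajorant z := by
  obtain ⟨C, n, hC, hb⟩ := exists_bound_pair hP
  refine ⟨C, n, hC, fun h m₁ m₂ s => ?_⟩
  filter_upwards [ae_ne_zero] with z hz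
  rw [pairFun, norm_mul, Complex.norm_real, Real.norm_of_nonneg (pairWeight_nonneg _ _ _)]
  have hS : 0 ≤ (Finset.Iic n).sup (schwartzSeminormFamily ℂ Mink ℂ) h := apply_nonneg _ _
  calc _ ≤ pairWeight m₁ m₂ z * _ :=
        mul_le_mul_of_nonneg_left (hb h m₁ m₂ s z) (pairWeight_nonneg _ _ _)
    _ = C * (Finset.Iic n).sup (schwartzSeminormFamily ℂ Mink ℂ) h *
        (pairWeight m₁ m₂ z * (((1 + ‖z.1‖) ^ 4)⁻¹ * ((1 + ‖z.2‖) ^ 4)⁻¹)) := by ring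
    _ ≤ _ := mul_le_mul_of_nonneg_left (pairWeight_le m₁ m₂ hz.1 hz.2) (by positivity)

lemma aestronglyMeasurable_pairFun (m₁ m₂ : ℝ) (s : ℤˣ) {P : Mink × Mink → ℂ}
    (hP : Continuous P) {h : Mink → ℂ} (hh : Continuous h) :
    AEStronglyMeasurable (pairFun m₁ m₂ s P h) := by
  have h1 := continuous_pairPoint m₁ m₂ s
  refine ((Complex.measurable_ofReal.comp (measurable_pairWeight m₁ m₂)).aestronglyMeasurable).mul
    (Continuous.aestronglyMeasurable ?_)
  exact (hh.comp (h1.fst.add h1.snd)).mul (hP.comp h1)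

lemma integrable_pairFun (m₁ m₂ : ℝ) (s : ℤˣ) {P : Mink × Mink → ℂ}
    (hP : P.HasTemperateGrowth) (h : 𝓢(Mink, ℂ)) : Integrable (pairFun m₁ m₂ s P h) := by
  obtain ⟨C, n, -, hb⟩ := exists_majorant_pairFun hP
  exact (integrable_pairMajorant.const_mul _).mono'
    (aestronglyMeasurable_pairFun m₁ m₂ s hP.1.continuous h.continuous) (hb h m₁ m₂ s)

/-! ### Products of positive or negative frequency solutions -/

/-- The constant `i / (2π)³` of the Pauli-Jordan distribution. -/
def pjConst : ℂ := Complex.I / (2 * Real.pi) ^ 3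

/-- `u` is the solution of the wave equation of mass `m`, of frequency sign `s`, with amplitude
`f(p)` relative to `D_m^{(s)}`. -/
structure IsShellWave (m : ℝ) (s : ℤˣ) (f : Mink → ℂ) (u : TDist) : Prop where
  temperate : f.HasTemperateGrowth
  apply_eq : ∀ φ : 𝓢(Mink, ℂ), u φ = ((s : ℤ) : ℂ) * pjConst *
    ∫ p : E3, (weight m p : ℂ) * (f (shellPoint m s p) * waveMinus φ (shellPoint m s p))

lemma isShellWave_pauliJordan (m : ℝ) (s : ℤˣ) : IsShellWave m s (fun _ => 1) (pauliJordan m s) := by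
  refine ⟨.const 1, fun φ => ?_⟩
  rw [pauliJordan_apply]
  simp only [← waveMinus_apply, one_mul]
  rw [integral_shell m s (waveMinus φ).continuous, pjConst]
  ring

lemma integrable_shell (m : ℝ) (s : ℤˣ) {f : Mink → ℂ} (hf : f.HasTemperateGrowth)
    (h : 𝓢(Mink, ℂ)) :
    Integrable fun p : E3 => (weight m p : ℂ) * (f (shellPoint m s p) * h (shellPoint m s p)) := by
  set g := SchwartzMap.smulLeftCLM ℂ f h with hg
  have hgx : ∀ x, g x = f x * h x := fun x => SchwartzMap.smulLeftCLM_apply_apply hf h x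
  simp only [← hgx]
  have hb := SchwartzMap.one_add_le_sup_seminorm_apply (𝕜 := ℂ) (m := (4, 0)) le_rfl le_rfl g
  simp only [norm_iteratedFDeriv_zero] at hb
  set C := 2 ^ (4, 0).1 * (Finset.Iic (4, 0)).sup (fun m => SchwartzMap.seminorm ℂ m.1 m.2) g
  refine (integrable_majorant.const_mul C).mono' ?_ ?_
  · exact (Complex.measurable_ofReal.comp (measurable_weight m)).aestronglyMeasurable.mul
      (g.continuous.comp (continuous_shellPoint m s)).aestronglyMeasurable
  · filter_upwards [Measure.ae_ne volume (0 : E3)] with p hp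
    have h1 := hb (shellPoint m s p)
    have h2 : (1 + ‖p‖) ^ 4 * ‖g (shellPoint m s p)‖ ≤ C :=
      le_trans (by gcongr; exact norm_le_norm_shellPoint m s p) h1
    rw [norm_mul, Complex.norm_real, Real.norm_of_nonneg (weight_nonneg _ _)]
    have h3 : ‖g (shellPoint m s p)‖ ≤ C * ((1 + ‖p‖) ^ 4)⁻¹ := by
      rw [← div_eq_mul_inv, le_div_iff₀ (by positivity)]; linarith
    calc _ ≤ ‖p‖⁻¹ * (C * ((1 + ‖p‖) ^ 4)⁻¹) :=
          mul_le_mul (weight_le m hp) h3 (norm_nonneg _) (by positivity)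
      _ = _ := by unfold majorant; ring

/-- A plane wave tested against `y ↦ ρ(x - y)`. -/
lemma waveMinus_reflectAt (ρ : 𝓢(Mink, ℂ)) (x p : Mink) :
    waveMinus (reflectAt ρ x) p =
      Complex.exp (-(Complex.I * (mdot p x : ℂ))) * wavePlus ρ p := by
  rw [waveMinus_apply, wavePlus_apply, ← integral_const_mul]
  rw [← integral_sub_left_eq_self _ volume x]
  refine integral_congr_ae (Eventually.of_forall fun y => ?_)
  simp only [reflectAt_apply, sub_sub_cancel, ← mul_assoc, ← Complex.exp_add]
  congr 2
  simp only [mdot_eq, PiLp.sub_apply]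
  push_cast
  ring

lemma mollify_shellWave {m : ℝ} {s : ℤˣ} {f : Mink → ℂ} {u : TDist} (hu : IsShellWave m s f u)
    (ρ : 𝓢(Mink, ℂ)) (x : Mink) :
    mollify u ρ x = ((s : ℤ) : ℂ) * pjConst * ∫ p : E3, (weight m p : ℂ) *
      (f (shellPoint m s p) * wavePlus ρ (shellPoint m s p)) *
        Complex.exp (-(Complex.I * (mdot (shellPoint m s p) x : ℂ))) := by
  rw [mollify, hu.apply_eq]
  congr 1
  refine integral_congr_ae (Eventually.of_forall fun p => ?_)
  simp only [waveMinus_reflectAt]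
  ring

lemma continuous_mdot_shell (m : ℝ) (s : ℤˣ) :
    Continuous fun z : Mink × E3 => mdot (shellPoint m s z.2) z.1 := by
  have h : ∀ i : Fin 4, Continuous fun z : Mink × E3 => shellPoint m s z.2 i * z.1 i := fun i =>
    ((PiLp.continuous_apply 2 _ i).comp ((continuous_shellPoint m s).comp continuous_snd)).mul
      ((PiLp.continuous_apply 2 _ i).comp continuous_fst)
  simp only [mdot_eq]
  exact (((h 0).sub (h 1)).sub (h 2)).sub (h 3)

/-- The product of two regularized waves of the same frequency sign, as a two-particle integral. -/
lemma integral_mollify_mul_mollify {m₁ m₂ : ℝ} {s : ℤˣ} {f g : Mink → ℂ} {u v : TDist}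
    (hu : IsShellWave m₁ s f u) (hv : IsShellWave m₂ s g v) (ρ σ φ : 𝓢(Mink, ℂ)) :
    ∫ x, mollify u ρ x * mollify v σ x * φ x = pjConst ^ 2 *
      ∫ z, wavePlus ρ (shellPoint m₁ s z.1) * wavePlus σ (shellPoint m₂ s z.2) *
        pairFun m₁ m₂ s (fun w => f w.1 * g w.2) (waveMinus φ) z := by
  let A : E3 → ℂ := fun p => (weight m₁ p : ℂ) *
      (f (shellPoint m₁ s p) * wavePlus ρ (shellPoint m₁ s p))
  let B : E3 → ℂ := fun p => (weight m₂ p : ℂ) *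
      (g (shellPoint m₂ s p) * wavePlus σ (shellPoint m₂ s p))
  have hA : Integrable A := integrable_shell m₁ s hu.temperate _
  have hB : Integrable B := integrable_shell m₂ s hv.temperate _
  let e : Mink → E3 × E3 → ℂ := fun x z =>
    Complex.exp (-(Complex.I * (mdot (shellPoint m₁ s z.1) x : ℂ))) *
      Complex.exp (-(Complex.I * (mdot (shellPoint m₂ s z.2) x : ℂ)))
  have hec : Continuous (Function.uncurry e) := by
    have h1 := (continuous_mdot_shell m₁ s).comp
      ((continuous_fst (X := Mink) (Y := E3 × E3)).prodMk continuous_snd.fst)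
    have h2 := (continuous_mdot_shell m₂ s).comp
      ((continuous_fst (X := Mink) (Y := E3 × E3)).prodMk continuous_snd.snd)
    simp only [Function.comp_def] at h1 h2
    change Continuous fun w : Mink × (E3 × E3) => _ * _
    fun_prop
  have hs : ((s : ℤ) : ℂ) * pjConst * (((s : ℤ) : ℂ) * pjConst) = pjConst ^ 2 := by
    linear_combination pjConst ^ 2 * sign_sq_complex s
  have step1 : ∀ x, mollify u ρ x * mollify v σ x * φ x =
      pjConst ^ 2 * ∫ z : E3 × E3, φ x * (A z.1 * B z.2) * e x z := by
    intro x
    rw [mollify_shellWave hu, mollify_shellWave hv, ← hs]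
    have h := integral_prod_mul (μ := (volume : Measure E3)) (ν := (volume : Measure E3))
      (fun p => A p * Complex.exp (-(Complex.I * (mdot (shellPoint m₁ s p) x : ℂ))))
      (fun p => B p * Complex.exp (-(Complex.I * (mdot (shellPoint m₂ s p) x : ℂ))))
    have h' : ∫ z : E3 × E3, φ x * (A z.1 * B z.2) * e x z = φ x * ∫ z : E3 × E3,
        (A z.1 * Complex.exp (-(Complex.I * (mdot (shellPoint m₁ s z.1) x : ℂ)))) *
        (B z.2 * Complex.exp (-(Complex.I * (mdot (shellPoint m₂ s z.2) x : ℂ)))) := by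
      rw [← integral_const_mul]
      refine integral_congr_ae (Eventually.of_forall fun z => ?_)
      simp only [e]; ring
    rw [h']
    erw [h]
    ring
  simp only [step1]
  rw [integral_const_mul]
  congr 1
  have hint : Integrable (Function.uncurry fun x (z : E3 × E3) => φ x * (A z.1 * B z.2) * e x z)
      ((volume : Measure Mink).prod (volume : Measure (E3 × E3))) := by
    have h1 : Integrable (fun w : Mink × (E3 × E3) => φ w.1 * (A w.2.1 * B w.2.2))
        ((volume : Measure Mink).prod (volume : Measure (E3 × E3))) :=
      φ.integrable.mul_prod (hA.mul_prod hB)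
    refine h1.mono (h1.aestronglyMeasurable.mul hec.aestronglyMeasurable)
      (Eventually.of_forall fun w => ?_)
    have : ‖e w.1 w.2‖ = 1 := by
      simp only [e, norm_mul]
      rw [← mul_neg, ← mul_neg, ← Complex.ofReal_neg, ← Complex.ofReal_neg,
        Complex.norm_exp_I_mul_ofReal, Complex.norm_exp_I_mul_ofReal, one_mul]
    rw [Function.uncurry_def]
    simp only [norm_mul (_ * _) (e _ _), this, mul_one, le_refl]
  rw [integral_integral_swap hint]
  refine integral_congr_ae (Eventually.of_forall fun z => ?_)
  simp only [pairFun, pairPoint, waveMinus_apply]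
  rw [← integral_mul_const, ← integral_const_mul, ← integral_const_mul]
  refine integral_congr_ae (Eventually.of_forall fun x => ?_)
  have he : e x z = Complex.exp (-(Complex.I *
      (mdot (shellPoint m₁ s z.1 + shellPoint m₂ s z.2) x : ℂ))) := by
    simp only [e, ← Complex.exp_add]
    congr 1
    simp only [mdot_eq, PiLp.add_apply]
    push_cast
    ring
  simp only [← he, A, B, pairWeight]
  push_cast
  ring

lemma norm_wavePlus_le (ρ : 𝓢(Mink, ℂ)) (p : Mink) : ‖wavePlus ρ p‖ ≤ ∫ x, ‖ρ x‖ := by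
  rw [wavePlus_apply]
  refine (norm_integral_le_integral_norm _).trans (le_of_eq ?_)
  refine integral_congr_ae (Eventually.of_forall fun x => ?_)
  simp only [norm_mul, Complex.norm_exp_I_mul_ofReal, one_mul]

lemma continuous_mdot (p : Mink) : Continuous fun x : Mink => mdot p x := by
  simp only [mdot_eq]; fun_prop

/-- The Fourier transforms of a delta sequence tend to `1`. -/
lemma IsDeltaSeq.tendsto_wavePlus {ρ : ℕ → 𝓢(Mink, ℂ)} (hρ : IsDeltaSeq ρ) (p : Mink) :
    Tendsto (fun n => wavePlus (ρ n) p) atTop (𝓝 1) := by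
  obtain ⟨C, hC⟩ := hρ.bounded
  have hC0 : 0 ≤ C := (integral_nonneg fun _ => norm_nonneg _).trans (hC 0)
  rw [Metric.tendsto_atTop']
  intro ε hε
  have hcont : ContinuousAt (fun x : Mink => Complex.exp (Complex.I * (mdot p x : ℂ))) 0 := by
    have := continuous_mdot p
    fun_prop
  obtain ⟨r, hr, hball⟩ := Metric.continuousAt_iff.1 hcont (ε / (C + 1)) (by positivity)
  have h0 : mdot p 0 = 0 := by simp [mdot_eq]
  simp only [h0, Complex.ofReal_zero, mul_zero, Complex.exp_zero, dist_eq_norm, sub_zero] at hball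
  obtain ⟨n0, hn0⟩ := eventually_atTop.1 (hρ.support_shrinks (r / 2) (by positivity))
  refine ⟨n0, fun n hn => ?_⟩
  have hsupp := hn0 n hn.le
  have hexp : Integrable fun x => Complex.exp (Complex.I * (mdot p x : ℂ)) * ρ n x := by
    have := continuous_mdot p
    refine (ρ n).integrable.mono (Continuous.aestronglyMeasurable (by fun_prop))
      (Eventually.of_forall fun x => ?_)
    simp only [norm_mul, Complex.norm_exp_I_mul_ofReal, one_mul, le_refl]
  rw [dist_eq_norm, wavePlus_apply, ← hρ.integral_eq_one n, ← integral_sub hexp (ρ n).integrable]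
  have hle : ∀ x, ‖Complex.exp (Complex.I * (mdot p x : ℂ)) * ρ n x - ρ n x‖ ≤
      ε / (C + 1) * ‖ρ n x‖ := by
    intro x
    by_cases hx : x ∈ tsupport (ρ n)
    · have h1 : ‖x‖ < r := by
        have := hsupp hx
        rw [mem_closedBall_zero_iff] at this
        linarith
      rw [show Complex.exp (Complex.I * (mdot p x : ℂ)) * ρ n x - ρ n x =
        (Complex.exp (Complex.I * (mdot p x : ℂ)) - 1) * ρ n x by ring, norm_mul]
      exact mul_le_mul_of_nonneg_right (hball h1).le (norm_nonneg _)
    · simp [image_eq_zero_of_notMem_tsupport hx]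
  calc _ ≤ ∫ x, ε / (C + 1) * ‖ρ n x‖ :=
        norm_integral_le_of_norm_le ((ρ n).integrable.norm.const_mul _) (Eventually.of_forall hle)
    _ = ε / (C + 1) * ∫ x, ‖ρ n x‖ := integral_const_mul _ _
    _ ≤ ε / (C + 1) * C := by gcongr; exact hC n
    _ < ε := by
        rw [div_mul_eq_mul_div, div_lt_iff₀ (by positivity)]
        nlinarith

/-- The functional `h ↦ ∫∫ P(p, q) h(p + q)` over pairs of momenta on two mass shells. -/
def pairCLM (m₁ m₂ : ℝ) (s : ℤˣ) (P : Mink × Mink → ℂ) (hP : P.HasTemperateGrowth) :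
    𝓢(Mink, ℂ) →L[ℂ] ℂ :=
  SchwartzMap.mkCLMtoNormedSpace (fun h => ∫ z, pairFun m₁ m₂ s P h z)
    (fun h k => by
      rw [← integral_add (integrable_pairFun m₁ m₂ s hP h) (integrable_pairFun m₁ m₂ s hP k)]
      refine integral_congr_ae (Eventually.of_forall fun z => ?_)
      simp only [pairFun, add_apply]
      ring)
    (fun a h => by
      rw [RingHom.id_apply, ← integral_smul]
      refine integral_congr_ae (Eventually.of_forall fun z => ?_)
      simp only [pairFun, smul_apply, smul_eq_mul]
      ring)
    (by
      obtain ⟨C, n, hC, hb⟩ := exists_majorant_pairFun hP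
      refine ⟨Finset.Iic n, C * ∫ z, pairMajorant z, mul_nonneg hC (integral_nonneg fun z => ?_),
        fun h => ?_⟩
      · unfold pairMajorant majorant; positivity
      · refine (norm_integral_le_of_norm_le (integrable_pairMajorant.const_mul _)
          (hb h m₁ m₂ s)).trans (le_of_eq ?_)
        rw [integral_const_mul]
        ring)

/-- The tempered distribution `φ ↦ (i / (2π)³)² ∫∫ P(p, q) φ̂(p + q)`. -/
def pairDist (m₁ m₂ : ℝ) (s : ℤˣ) (P : Mink × Mink → ℂ) (hP : P.HasTemperateGrowth) : TDist :=
  pjConst ^ 2 • PointwiseConvergenceCLM.precomp ℂ waveMinus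
    (ContinuousLinearMap.toPointwiseConvergenceCLM _ _ _ _ (pairCLM m₁ m₂ s P hP))

lemma pairDist_apply (m₁ m₂ : ℝ) (s : ℤˣ) (P : Mink × Mink → ℂ) (hP : P.HasTemperateGrowth)
    (φ : 𝓢(Mink, ℂ)) : pairDist m₁ m₂ s P hP φ =
      pjConst ^ 2 * ∫ z, pairFun m₁ m₂ s P (waveMinus φ) z := rfl

lemma hasTemperateGrowth_amplitude {f g : Mink → ℂ} (hf : f.HasTemperateGrowth)
    (hg : g.HasTemperateGrowth) :
    (fun w : Mink × Mink => f w.1 * g w.2).HasTemperateGrowth :=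
  (hf.comp (ContinuousLinearMap.fst ℝ Mink Mink).hasTemperateGrowth).mul
    (hg.comp (ContinuousLinearMap.snd ℝ Mink Mink).hasTemperateGrowth)

/-- Waves of the same frequency sign can be multiplied. -/
lemma isProd_shellWave {m₁ m₂ : ℝ} {s : ℤˣ} {f g : Mink → ℂ} {u v : TDist}
    (hu : IsShellWave m₁ s f u) (hv : IsShellWave m₂ s g v) :
    IsProd u v (pairDist m₁ m₂ s (fun w => f w.1 * g w.2)
      (hasTemperateGrowth_amplitude hu.temperate hv.temperate)) := by
  intro ρ σ hρ hσ φ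
  have hP := hasTemperateGrowth_amplitude hu.temperate hv.temperate
  simp only [integral_mollify_mul_mollify hu hv, pairDist_apply]
  refine Tendsto.const_mul _ ?_
  obtain ⟨C, hC⟩ := hρ.bounded
  obtain ⟨C', hC'⟩ := hσ.bounded
  have hI := integrable_pairFun m₁ m₂ s hP (waveMinus φ)
  have hC0 : 0 ≤ C := (integral_nonneg fun _ => norm_nonneg _).trans (hC 0)
  refine tendsto_integral_of_dominated_convergence
    (fun z => C * C' * ‖pairFun m₁ m₂ s (fun w => f w.1 * g w.2) (waveMinus φ) z‖) ?_ ?_ ?_ ?_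
  · intro n
    refine AEStronglyMeasurable.mul (Continuous.aestronglyMeasurable ?_) hI.aestronglyMeasurable
    exact ((wavePlus (ρ n)).continuous.comp ((continuous_shellPoint m₁ s).comp continuous_fst)).mul
      ((wavePlus (σ n)).continuous.comp ((continuous_shellPoint m₂ s).comp continuous_snd))
  · exact hI.norm.const_mul _
  · intro n
    refine Eventually.of_forall fun z => ?_
    rw [norm_mul, norm_mul]
    gcongr
    · exact (norm_wavePlus_le _ _).trans (hC n)
    · exact (norm_wavePlus_le _ _).trans (hC' n)
  · refine Eventually.of_forall fun z => ?_
    have := ((hρ.tendsto_wavePlus (shellPoint m₁ s z.1)).mul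
      (hσ.tendsto_wavePlus (shellPoint m₂ s z.2))).mul_const
      (pairFun m₁ m₂ s (fun w => f w.1 * g w.2) (waveMinus φ) z)
    simpa using this

lemma IsProd.hasProd {u v w : TDist} (h : IsProd u v w) : HasProd u v := ⟨w, h⟩

lemma IsProd.distMul_eq {u v w : TDist} (h : IsProd u v w) : distMul u v = w := by
  rw [distMul, dif_pos h.hasProd]
  exact h.hasProd.choose_spec.unique h

/-! ### Differentiation in momentum space -/

/-- The covariant component `p_μ = η_{μμ} p^μ`. -/
def lower (μ : Fin 4) (p : Mink) : ℝ := eta μ μ * p μ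

lemma hasTemperateGrowth_coord (μ : Fin 4) : (fun p : Mink => ((p μ : ℝ) : ℂ)).HasTemperateGrowth :=
  (Complex.ofRealCLM ∘L
    (EuclideanSpace.proj μ : EuclideanSpace ℝ (Fin 4) →L[ℝ] ℝ)).hasTemperateGrowth

lemma hasTemperateGrowth_lower (μ : Fin 4) :
    (fun p : Mink => ((lower μ p : ℝ) : ℂ)).HasTemperateGrowth := by
  unfold lower
  push_cast
  exact (Function.HasTemperateGrowth.const _).mul (hasTemperateGrowth_coord μ)

lemma waveMinus_lineDeriv (μ : Fin 4) (φ : 𝓢(Mink, ℂ)) (p : Mink) :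
    waveMinus (∂_{(EuclideanSpace.single μ (1 : ℝ) : Mink)} φ) p =
      Complex.I * (lower μ p : ℂ) * waveMinus φ p := by
  have h : ∀ ψ : 𝓢(Mink, ℂ), waveMinus ψ p = (𝓕 ψ) (freq p) := fun ψ => rfl
  have hpi : (Real.pi : ℂ) ≠ 0 := by exact_mod_cast Real.pi_ne_zero
  rw [h, h, SchwartzMap.fourier_lineDerivOp_eq, smul_apply,
    SchwartzMap.smulLeftCLM_apply_apply (by fun_prop), EuclideanSpace.inner_single_right,
    freq_apply]
  simp only [lower, Complex.real_smul, smul_eq_mul]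
  push_cast
  simp
  field_simp

lemma pd_apply (μ : Fin 4) (u : TDist) (φ : 𝓢(Mink, ℂ)) :
    pd μ u φ = u (-∂_{(EuclideanSpace.single μ (1 : ℝ) : Mink)} φ) :=
  TemperedDistribution.lineDerivOp_apply_apply _ _ _

lemma waveMinus_neg_lineDeriv (μ : Fin 4) (φ : 𝓢(Mink, ℂ)) (p : Mink) :
    waveMinus (-∂_{(EuclideanSpace.single μ (1 : ℝ) : Mink)} φ) p =
      -Complex.I * (lower μ p : ℂ) * waveMinus φ p := by
  rw [map_neg, neg_apply, waveMinus_lineDeriv]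
  ring

lemma IsShellWave.pd {m : ℝ} {s : ℤˣ} {f : Mink → ℂ} {u : TDist} (hu : IsShellWave m s f u)
    (μ : Fin 4) :
    IsShellWave m s (fun p => -Complex.I * (lower μ p : ℂ) * f p) (pd μ u) := by
  refine ⟨((Function.HasTemperateGrowth.const _).mul (hasTemperateGrowth_lower μ)).mul
    hu.temperate, fun φ => ?_⟩
  rw [pd_apply, hu.apply_eq]
  congr 1
  refine integral_congr_ae (Eventually.of_forall fun p => ?_)
  simp only [waveMinus_neg_lineDeriv]
  ring

lemma IsShellWave.smul {m : ℝ} {s : ℤˣ} {f : Mink → ℂ} {u : TDist} (hu : IsShellWave m s f u)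
    (c : ℂ) : IsShellWave m s (fun p => c * f p) (c • u) := by
  refine ⟨(Function.HasTemperateGrowth.const _).mul hu.temperate, fun φ => ?_⟩
  change c * u φ = _
  rw [hu.apply_eq, mul_left_comm, ← integral_const_mul c]
  congr 2
  funext p
  ring

/-! ### Distributions given by two-particle integrals -/

/-- `u(φ) = (i / (2π)³)² (I⁺ - I⁻)`, where `I^±` is the integral of `P(p, q) φ̂(p + q)` over the pairs
of momenta on the two mass shells of sign `±`. -/
structure IsPairWave (m₁ m₂ : ℝ) (P : Mink × Mink → ℂ) (u : TDist) : Prop where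
  temperate : P.HasTemperateGrowth
  apply_eq : ∀ φ : 𝓢(Mink, ℂ), u φ = pjConst ^ 2 *
    ((∫ z, pairFun m₁ m₂ 1 P (waveMinus φ) z) - ∫ z, pairFun m₁ m₂ (-1) P (waveMinus φ) z)

lemma hasCausal_of_isShellWave {m₁ m₂ : ℝ} {A B : Split} {f g : Mink → ℂ}
    (hA : ∀ s, IsShellWave m₁ s f (A s)) (hB : ∀ s, IsShellWave m₂ s g (B s)) : HasCausal A B :=
  ⟨(isProd_shellWave (hA 1) (hB 1)).hasProd, (isProd_shellWave (hA (-1)) (hB (-1))).hasProd⟩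

lemma isPairWave_causal {m₁ m₂ : ℝ} {A B : Split} {f g : Mink → ℂ}
    (hA : ∀ s, IsShellWave m₁ s f (A s)) (hB : ∀ s, IsShellWave m₂ s g (B s)) :
    IsPairWave m₁ m₂ (fun w => f w.1 * g w.2) (causal A B) := by
  refine ⟨hasTemperateGrowth_amplitude (hA 1).temperate (hB 1).temperate, fun φ => ?_⟩
  rw [causal, (isProd_shellWave (hA 1) (hB 1)).distMul_eq,
    (isProd_shellWave (hA (-1)) (hB (-1))).distMul_eq, mul_sub]
  rfl

section

variable {m₁ m₂ : ℝ} {P Q : Mink × Mink → ℂ} {u v : TDist}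

lemma IsPairWave.congr (hu : IsPairWave m₁ m₂ P u) (h : P = Q) : IsPairWave m₁ m₂ Q u := h ▸ hu

lemma IsPairWave.smul (hu : IsPairWave m₁ m₂ P u) (c : ℂ) :
    IsPairWave m₁ m₂ (fun w => c * P w) (c • u) := by
  refine ⟨(Function.HasTemperateGrowth.const _).mul hu.temperate, fun φ => ?_⟩
  have h : ∀ s, ∫ z, pairFun m₁ m₂ s (fun w => c * P w) (waveMinus φ) z =
      c * ∫ z, pairFun m₁ m₂ s P (waveMinus φ) z := by
    intro s
    rw [← integral_const_mul]
    congr 1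
    funext z
    simp only [pairFun]
    ring
  change c * u φ = _
  rw [hu.apply_eq, h, h]
  ring

lemma IsPairWave.add (hu : IsPairWave m₁ m₂ P u) (hv : IsPairWave m₁ m₂ Q v) :
    IsPairWave m₁ m₂ (fun w => P w + Q w) (u + v) := by
  refine ⟨hu.temperate.add hv.temperate, fun φ => ?_⟩
  have h : ∀ s, ∫ z, pairFun m₁ m₂ s (fun w => P w + Q w) (waveMinus φ) z =
      (∫ z, pairFun m₁ m₂ s P (waveMinus φ) z) + ∫ z, pairFun m₁ m₂ s Q (waveMinus φ) z := by
    intro s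
    rw [← integral_add (integrable_pairFun m₁ m₂ s hu.temperate _)
      (integrable_pairFun m₁ m₂ s hv.temperate _)]
    congr 1
    funext z
    simp only [pairFun]
    ring
  change u φ + v φ = _
  rw [hu.apply_eq, hv.apply_eq, h, h]
  ring

lemma IsPairWave.sub (hu : IsPairWave m₁ m₂ P u) (hv : IsPairWave m₁ m₂ Q v) :
    IsPairWave m₁ m₂ (fun w => P w - Q w) (u - v) := by
  have h := hu.add (hv.smul (-1))
  have e : u + (-1 : ℂ) • v = u - v := by module
  rw [e] at h
  exact h.congr (by funext w; ring)

lemma hasTemperateGrowth_total {χ : Mink → ℂ} (hχ : χ.HasTemperateGrowth) :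
    (fun w : Mink × Mink => χ (w.1 + w.2)).HasTemperateGrowth :=
  hχ.comp (ContinuousLinearMap.fst ℝ Mink Mink + ContinuousLinearMap.snd ℝ Mink Mink).hasTemperateGrowth

lemma IsPairWave.pd (hu : IsPairWave m₁ m₂ P u) (μ : Fin 4) :
    IsPairWave m₁ m₂ (fun w => -Complex.I * (lower μ (w.1 + w.2) : ℂ) * P w) (pd μ u) := by
  refine ⟨((Function.HasTemperateGrowth.const _).mul
    (hasTemperateGrowth_total (hasTemperateGrowth_lower μ))).mul hu.temperate, fun φ => ?_⟩
  rw [pd_apply, hu.apply_eq]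
  congr 1
  congr 1 <;>
  · congr 1
    funext z
    simp only [pairFun, waveMinus_neg_lineDeriv]
    ring

lemma box_eq (u : TDist) : box u =
    CausalDist.pd 0 (CausalDist.pd 0 u) - CausalDist.pd 1 (CausalDist.pd 1 u)
      - CausalDist.pd 2 (CausalDist.pd 2 u) - CausalDist.pd 3 (CausalDist.pd 3 u) := by
  simp only [box, Fin.sum_univ_four, eta, Fin.reduceEq, if_true, if_false]
  push_cast
  module

lemma IsPairWave.box (hu : IsPairWave m₁ m₂ P u) :
    IsPairWave m₁ m₂ (fun w => -(mdot (w.1 + w.2) (w.1 + w.2) : ℂ) * P w) (box u) := by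
  rw [box_eq]
  refine (((((hu.pd 0).pd 0).sub ((hu.pd 1).pd 1)).sub ((hu.pd 2).pd 2)).sub
    ((hu.pd 3).pd 3)).congr ?_
  funext w
  simp only [lower, mdot_eq, eta, Fin.reduceEq, if_true, if_false, PiLp.add_apply]
  push_cast
  linear_combination ((w.1 0 + w.2 0 : ℂ) ^ 2 - (w.1 1 + w.2 1) ^ 2 - (w.1 2 + w.2 2) ^ 2
    - (w.1 3 + w.2 3) ^ 2) * P w * Complex.I_sq

lemma IsPairWave.transOp (hu : IsPairWave m₁ m₂ P u) (μ ν : Fin 4) :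
    IsPairWave m₁ m₂ (fun w => -((lower μ (w.1 + w.2) : ℂ) * (lower ν (w.1 + w.2) : ℂ)
      - (eta μ ν : ℂ) * (mdot (w.1 + w.2) (w.1 + w.2) : ℂ)) * P w) (transOp μ ν u) := by
  refine (((hu.pd ν).pd μ).sub (hu.box.smul _)).congr ?_
  funext w
  linear_combination (lower μ (w.1 + w.2) : ℂ) * (lower ν (w.1 + w.2) : ℂ) * P w * Complex.I_sq

/-- `P` is a *null amplitude*: all two-particle integrals `∫∫ P(p, q) h(p + q)` vanish, i.e. the
mean of `P` at fixed total momentum is zero. -/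
def IsNull (m₁ m₂ : ℝ) (s : ℤˣ) (P : Mink × Mink → ℂ) : Prop :=
  ∀ h : 𝓢(Mink, ℂ), Integrable (pairFun m₁ m₂ s P h) ∧ ∫ z, pairFun m₁ m₂ s P h z = 0

/-- Amplitudes that differ by a null amplitude define the same distribution. -/
lemma IsPairWave.eq_of_isNull (hu : IsPairWave m₁ m₂ P u) (hv : IsPairWave m₁ m₂ Q v)
    (h : ∀ s, IsNull m₁ m₂ s fun w => P w - Q w) : u = v := by
  ext φ
  rw [← sub_eq_zero]
  change (u - v) φ = 0
  rw [(hu.sub hv).apply_eq, (h 1 _).2, (h (-1) _).2, sub_zero, mul_zero]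

end

/-! ### Multiplication in momentum space -/

/-- Fourier inversion for the plane waves of the Minkowski product, up to a constant. -/
lemma exists_wavePlus_smul_waveMinus : ∃ κ : ℂ, κ ≠ 0 ∧
    (∀ φ, wavePlus (κ • waveMinus φ) = φ) ∧ ∀ ψ, waveMinus (κ • wavePlus ψ) = ψ := by
  let κ : ℝ := |(freq : Mink →L[ℝ] Mink).det|
  have hκ : κ ≠ 0 := abs_ne_zero.2 (LinearEquiv.isUnit_det' freq.toLinearEquiv).ne_zero
  have h1 : ∀ φ, wavePlus ((κ : ℂ) • waveMinus φ) = φ := by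
    intro φ
    have e : (κ : ℂ) • waveMinus φ =
        𝓕 (compCLMOfContinuousLinearEquiv ℂ freq.symm φ : 𝓢(Mink, ℂ)) := by
      ext ξ
      rw [smul_apply, waveMinus_apply, SchwartzMap.fourier_coe, Real.fourier_eq']
      have hcv := integral_image_eq_integral_abs_det_fderiv_smul (μ := volume)
        (s := Set.univ) MeasurableSet.univ
        (f := freq) (f' := fun _ => (freq : Mink →L[ℝ] Mink))
        (fun x _ => freq.hasFDerivAt.hasFDerivWithinAt) freq.injective.injOn
        (fun x => Complex.exp (↑(-2 * Real.pi * inner ℝ x ξ) * Complex.I) •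
          (compCLMOfContinuousLinearEquiv ℂ freq.symm φ : 𝓢(Mink, ℂ)) x)
      rw [Set.image_univ, freq.surjective.range_eq, Measure.restrict_univ] at hcv
      rw [hcv, integral_smul, Complex.real_smul]
      congr 1
      refine integral_congr_ae (Eventually.of_forall fun x => ?_)
      simp only [compCLMOfContinuousLinearEquiv_apply, Function.comp_apply,
        ContinuousLinearEquiv.symm_apply_apply, smul_eq_mul]
      congr 2
      have h2 := two_pi_inner_freq ξ x
      have h3 : mdot x ξ = mdot ξ x := by simp only [mdot_eq]; ring
      rw [real_inner_comm] at h2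
      rw [← h3, ← h2]
      push_cast
      ring
    rw [e]
    change compCLMOfContinuousLinearEquiv ℂ freq
      (𝓕⁻ (𝓕 (compCLMOfContinuousLinearEquiv ℂ freq.symm φ : 𝓢(Mink, ℂ)))) = φ
    rw [FourierTransform.fourierInv_fourier_eq]
    ext x
    simp
  refine ⟨κ, by exact_mod_cast hκ, h1, fun ψ => ?_⟩
  have hinj : Function.Injective wavePlus := by
    intro a b hab
    have h2 : (𝓕⁻ a : 𝓢(Mink, ℂ)) = 𝓕⁻ b := by
      ext x
      have := congrArg (fun g : 𝓢(Mink, ℂ) => g (freq.symm x)) hab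
      change (𝓕⁻ a : 𝓢(Mink, ℂ)) (freq (freq.symm x)) = (𝓕⁻ b : 𝓢(Mink, ℂ)) (freq (freq.symm x))
        at this
      simpa using this
    have h3 := congrArg (fun g : 𝓢(Mink, ℂ) => 𝓕 g) h2
    simpa [FourierTransform.fourier_fourierInv_eq] using h3
  apply hinj
  rw [map_smul waveMinus, h1]

/-- A multiplier in the Fourier transform acts on amplitudes as a function of the total momentum. -/
lemma IsPairWave.exists_fourierM_eq_smulLeftCLM {m₁ m₂ : ℝ} {P : Mink × Mink → ℂ} {u : TDist}
    (hu : IsPairWave m₁ m₂ P u) {χ : Mink → ℂ} (hχ : χ.HasTemperateGrowth) :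
    ∃ w, IsPairWave m₁ m₂ (fun z => χ (z.1 + z.2) * P z) w ∧
      fourierM w = TemperedDistribution.smulLeftCLM ℂ χ (fourierM u) := by
  obtain ⟨κ, -, h1, h2⟩ := exists_wavePlus_smul_waveMinus
  let T : 𝓢(Mink, ℂ) →L[ℂ] 𝓢(Mink, ℂ) :=
    κ • (wavePlus ∘L SchwartzMap.smulLeftCLM ℂ χ ∘L waveMinus)
  have hT : ∀ φ, T φ = κ • wavePlus (SchwartzMap.smulLeftCLM ℂ χ (waveMinus φ)) := fun φ => rfl
  refine ⟨PointwiseConvergenceCLM.precomp ℂ T u,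
    ⟨(hasTemperateGrowth_total hχ).mul hu.temperate, fun φ => ?_⟩, ?_⟩
  · change u (T φ) = _
    have h3 : waveMinus (T φ) = SchwartzMap.smulLeftCLM ℂ χ (waveMinus φ) := by rw [hT, h2]
    rw [hu.apply_eq, h3]
    congr 1
    congr 1 <;>
    · congr 1
      funext z
      simp only [pairFun, SchwartzMap.smulLeftCLM_apply_apply hχ, smul_eq_mul]
      ring
  · ext ψ
    change _ * u (T (wavePlus ψ)) = _ * u (wavePlus (SchwartzMap.smulLeftCLM ℂ χ ψ))
    rw [hT, ← map_smul, ← map_smul, ← map_smul, h2]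

/-- The Fourier transform vanishes off the set of total momenta. -/
lemma IsPairWave.isVanishingOn {m₁ m₂ : ℝ} {P : Mink × Mink → ℂ} {u : TDist}
    (hu : IsPairWave m₁ m₂ P u) {U : Set Mink}
    (hU : ∀ s z, (pairPoint m₁ m₂ s z).1 + (pairPoint m₁ m₂ s z).2 ∈ U) :
    Distribution.IsVanishingOn (fourierM u) Uᶜ := by
  obtain ⟨κ, hκ, -, h2⟩ := exists_wavePlus_smul_waveMinus
  intro ψ hψ
  change _ * u (wavePlus ψ) = 0
  have h0 : ∀ s z, pairFun m₁ m₂ s P (waveMinus (wavePlus ψ)) z = 0 := by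
    intro s z
    have h3 : waveMinus (wavePlus ψ) ((pairPoint m₁ m₂ s z).1 + (pairPoint m₁ m₂ s z).2) = 0 := by
      have h4 := congrArg
        (fun g : 𝓢(Mink, ℂ) => g ((pairPoint m₁ m₂ s z).1 + (pairPoint m₁ m₂ s z).2)) (h2 ψ)
      have h5 : ψ ((pairPoint m₁ m₂ s z).1 + (pairPoint m₁ m₂ s z).2) = 0 :=
        image_eq_zero_of_notMem_tsupport fun hx => hψ hx (hU s z)
      simp only [map_smul, smul_apply, smul_eq_mul, h5] at h4
      exact (mul_eq_zero.1 h4).resolve_left hκ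
    rw [pairFun, h3, zero_mul, mul_zero]
  rw [hu.apply_eq]
  simp [h0]

lemma IsDivKSq.divKSq_eq {n : ℕ} {u w : TDist} (h : IsDivKSq n u w) : divKSq n u = w := by
  have h' : HasDivKSq n u := ⟨w, h⟩
  rw [divKSq, dif_pos h']
  exact h'.choose_spec.unique h

/-! ### Integration by parts at fixed total spatial momentum -/

/-- The direction that moves `p` along the `i`-th axis at fixed total spatial momentum `p + q`. -/
def exchangeDir (i : Fin 3) : E3 × E3 :=
  (EuclideanSpace.single i 1, -EuclideanSpace.single i 1)

/-- The relative velocity `p / ω₁(p) - q / ω₂(q)`; it is the gradient of the total energy at fixed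
total spatial momentum. -/
def relVel (m₁ m₂ : ℝ) (j : Fin 3) (z : E3 × E3) : ℝ :=
  z.1 j / energy m₁ z.1 - z.2 j / energy m₂ z.2

/-- The mixed second derivatives of the total energy at fixed total spatial momentum. -/
def relVelDeriv (m₁ m₂ : ℝ) (i j : Fin 3) (z : E3 × E3) : ℝ :=
  -(z.1 i * z.1 j / energy m₁ z.1 ^ 3) - z.2 i * z.2 j / energy m₂ z.2 ^ 3

lemma hasDerivAt_energy {m : ℝ} (hm : 0 < m) (p : E3) (c : ℝ) (i : Fin 3) :
    HasDerivAt (fun t : ℝ => energy m (p + t • (c • EuclideanSpace.single i (1 : ℝ))))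
      (c * p i / energy m p) 0 := by
  have hf : (fun t : ℝ => energy m (p + t • (c • EuclideanSpace.single i (1 : ℝ)))) =
      fun t => Real.sqrt (energy m p ^ 2 + (2 * (c * p i) * t + c ^ 2 * t ^ 2)) := by
    funext t
    rw [energy_sq, energy, norm_add_sq_real, smul_smul, inner_smul_right,
      EuclideanSpace.inner_single_right, norm_smul, PiLp.norm_single]
    congr 1
    simp only [norm_one, mul_one, Real.norm_eq_abs, sq_abs, one_mul]
    simp
    ring
  rw [hf]
  have h1 : HasDerivAt (fun t : ℝ => energy m p ^ 2 + (2 * (c * p i) * t + c ^ 2 * t ^ 2))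
      (2 * (c * p i)) 0 := by
    have := (((hasDerivAt_id (0 : ℝ)).const_mul (2 * (c * p i))).add
      (((hasDerivAt_id (0 : ℝ)).pow 2).const_mul (c ^ 2))).const_add (energy m p ^ 2)
    simpa using this
  have hpos := energy_pos hm p
  have h2 := h1.sqrt (by simp; exact hpos.ne')
  simp only [mul_zero, zero_pow two_ne_zero, add_zero, Real.sqrt_sq hpos.le] at h2
  convert h2 using 1
  field_simp

lemma hasDerivAt_velocity {m : ℝ} (hm : 0 < m) (p : E3) (c : ℝ) {i j : Fin 3} (hij : i ≠ j) :
    HasDerivAt (fun t : ℝ => (p + t • (c • EuclideanSpace.single i (1 : ℝ)) : E3) j /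
        energy m (p + t • (c • EuclideanSpace.single i (1 : ℝ))))
      (-(c * (p i * p j / energy m p ^ 3))) 0 := by
  have hf : (fun t : ℝ => (p + t • (c • EuclideanSpace.single i (1 : ℝ)) : E3) j /
      energy m (p + t • (c • EuclideanSpace.single i (1 : ℝ)))) =
      fun t => p j * (energy m (p + t • (c • EuclideanSpace.single i (1 : ℝ))))⁻¹ := by
    funext t
    simp [hij.symm, div_eq_mul_inv]
  have hpos := energy_pos hm p
  rw [hf]
  have := ((hasDerivAt_energy hm p c i).inv (by simpa using hpos.ne')).const_mul (p j)
  simp only [zero_smul, add_zero] at this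
  refine this.congr_deriv ?_
  field_simp

lemma hasDerivAt_relVel {m₁ m₂ : ℝ} (h1 : 0 < m₁) (h2 : 0 < m₂) {i j : Fin 3} (hij : i ≠ j)
    (z : E3 × E3) :
    HasDerivAt (fun t : ℝ => relVel m₁ m₂ j (z + t • exchangeDir i)) (relVelDeriv m₁ m₂ i j z) 0 := by
  have ha := hasDerivAt_velocity h1 z.1 1 hij
  have hb := hasDerivAt_velocity h2 z.2 (-1) hij
  simp only [one_smul, neg_one_smul] at ha hb
  refine HasDerivAt.congr_deriv (ha.sub hb) ?_
  simp only [relVelDeriv]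
  ring

/-- The total momentum moves along the energy axis, with the speed `relVel`. -/
lemma hasDerivAt_total {m₁ m₂ : ℝ} (h1 : 0 < m₁) (h2 : 0 < m₂) (s : ℤˣ) (i : Fin 3)
    (z : E3 × E3) :
    HasDerivAt (fun t : ℝ => (pairPoint m₁ m₂ s (z + t • exchangeDir i)).1 +
        (pairPoint m₁ m₂ s (z + t • exchangeDir i)).2)
      ((((s : ℤ) : ℝ) * relVel m₁ m₂ i z) • (EuclideanSpace.single 0 1 : Mink)) 0 := by
  have ha := hasDerivAt_energy h1 z.1 1 i
  have hb := hasDerivAt_energy h2 z.2 (-1) i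
  simp only [one_smul, neg_one_smul, one_mul, neg_one_mul] at ha hb
  have h := (((ha.add hb).const_mul ((s : ℤ) : ℝ)).sub_const
    (((s : ℤ) : ℝ) * (energy m₁ z.1 + energy m₂ z.2))).smul_const (EuclideanSpace.single 0 1 : Mink)
  have h' := h.const_add ((pairPoint m₁ m₂ s z).1 + (pairPoint m₁ m₂ s z).2)
  have e : ((s : ℤ) : ℝ) * (z.1 i / energy m₁ z.1 + -z.2 i / energy m₂ z.2) =
      ((s : ℤ) : ℝ) * relVel m₁ m₂ i z := by simp only [relVel]; ring
  rw [e] at h'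
  refine h'.congr_of_eventuallyEq (Eventually.of_forall fun t => ?_)
  ext μ
  refine Fin.cases ?_ (fun l => ?_) μ
  · simp [pairPoint, exchangeDir]
    ring
  · simp [pairPoint, exchangeDir]
    ring

lemma abs_coord_le (p : E3) (i : Fin 3) : |p i| ≤ ‖p‖ := by
  simpa using PiLp.norm_apply_le p i

lemma abs_velocity_le (m : ℝ) (p : E3) (i : Fin 3) : |p i / energy m p| ≤ 1 := by
  rw [abs_div, abs_of_nonneg (energy_nonneg m p)]
  exact div_le_one_of_le₀ ((abs_coord_le p i).trans (norm_le_energy m p)) (energy_nonneg m p)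

lemma abs_relVel_le (m₁ m₂ : ℝ) (j : Fin 3) (z : E3 × E3) : |relVel m₁ m₂ j z| ≤ 2 := by
  have h1 := abs_velocity_le m₁ z.1 j
  have h2 := abs_velocity_le m₂ z.2 j
  refine (abs_sub _ _).trans ?_
  linarith

lemma abs_velocityDeriv_le {m : ℝ} (hm : 0 < m) (p : E3) (i j : Fin 3) :
    |p i * p j / energy m p ^ 3| ≤ m⁻¹ := by
  have hpos := energy_pos hm p
  have h1 := abs_velocity_le m p i
  have h2 := abs_velocity_le m p j
  have hme : m ≤ energy m p := Real.le_sqrt_of_sq_le (by nlinarith [sq_nonneg ‖p‖])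
  have e : p i * p j / energy m p ^ 3 =
      (p i / energy m p) * (p j / energy m p) * (energy m p)⁻¹ := by field_simp
  rw [e, abs_mul, abs_mul, abs_of_pos (inv_pos.2 hpos)]
  have h3 : (energy m p)⁻¹ ≤ m⁻¹ := inv_anti₀ hm hme
  calc _ ≤ 1 * 1 * m⁻¹ := by gcongr
    _ = _ := by ring

lemma abs_relVelDeriv_le {m₁ m₂ : ℝ} (h1 : 0 < m₁) (h2 : 0 < m₂) (i j : Fin 3) (z : E3 × E3) :
    |relVelDeriv m₁ m₂ i j z| ≤ m₁⁻¹ + m₂⁻¹ := by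
  refine (abs_sub _ _).trans ?_
  rw [abs_neg]
  exact add_le_add (abs_velocityDeriv_le h1 _ _ _) (abs_velocityDeriv_le h2 _ _ _)

lemma continuous_relVel {m₁ m₂ : ℝ} (h1 : 0 < m₁) (h2 : 0 < m₂) (j : Fin 3) :
    Continuous (relVel m₁ m₂ j) := by
  unfold relVel
  refine .sub (.div ?_ ((continuous_energy m₁).comp continuous_fst) fun z => (energy_pos h1 _).ne')
    (.div ?_ ((continuous_energy m₂).comp continuous_snd) fun z => (energy_pos h2 _).ne')
  · exact (PiLp.continuous_apply 2 _ j).comp continuous_fst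
  · exact (PiLp.continuous_apply 2 _ j).comp continuous_snd

lemma continuous_relVelDeriv {m₁ m₂ : ℝ} (h1 : 0 < m₁) (h2 : 0 < m₂) (i j : Fin 3) :
    Continuous (relVelDeriv m₁ m₂ i j) := by
  unfold relVelDeriv
  have hf : ∀ i : Fin 3, Continuous fun z : E3 × E3 => z.1 i := fun i =>
    (PiLp.continuous_apply 2 _ i).comp continuous_fst
  have hs : ∀ i : Fin 3, Continuous fun z : E3 × E3 => z.2 i := fun i =>
    (PiLp.continuous_apply 2 _ i).comp continuous_snd
  refine .sub (.neg (.div ((hf i).mul (hf j))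
    (((continuous_energy m₁).comp continuous_fst).pow 3) fun z => pow_ne_zero 3 (energy_pos h1 _).ne'))
    (.div ((hs i).mul (hs j))
    (((continuous_energy m₂).comp continuous_snd).pow 3) fun z => pow_ne_zero 3 (energy_pos h2 _).ne')

lemma integrable_pair_mul {m₁ m₂ : ℝ} {s : ℤˣ} {P : Mink × Mink → ℂ} (hP : P.HasTemperateGrowth)
    (h : 𝓢(Mink, ℂ)) {b : E3 × E3 → ℝ} (hb : Continuous b) {C : ℝ} (hC : ∀ z, |b z| ≤ C) :
    Integrable fun z => h ((pairPoint m₁ m₂ s z).1 + (pairPoint m₁ m₂ s z).2) *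
      P (pairPoint m₁ m₂ s z) * (b z : ℂ) := by
  obtain ⟨K, n, hK, hbd⟩ := exists_bound_pair hP
  have h1 := continuous_pairPoint m₁ m₂ s
  have hcont : Continuous fun z => h ((pairPoint m₁ m₂ s z).1 + (pairPoint m₁ m₂ s z).2) *
      P (pairPoint m₁ m₂ s z) :=
    (h.continuous.comp (h1.fst.add h1.snd)).mul (hP.1.continuous.comp h1)
  have hint : Integrable fun p : E3 => ((1 + ‖p‖) ^ 4)⁻¹ := by
    have := integrable_one_add_norm (E := E3) (μ := volume) (r := 4) (by simp; norm_num)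
    refine this.congr (Eventually.of_forall fun p => ?_)
    simp only
    rw [Real.rpow_neg (by positivity)]
    norm_cast
  have hint2 := hint.mul_prod hint
  have hint3 : Integrable fun z => h ((pairPoint m₁ m₂ s z).1 + (pairPoint m₁ m₂ s z).2) *
      P (pairPoint m₁ m₂ s z) :=
    (hint2.const_mul (K * (Finset.Iic n).sup (schwartzSeminormFamily ℂ Mink ℂ) h)).mono'
      hcont.aestronglyMeasurable (Eventually.of_forall fun z => hbd h m₁ m₂ s z)
  refine hint3.mul_bdd (c := C) (Complex.continuous_ofReal.comp hb).aestronglyMeasurable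
    (Eventually.of_forall fun z => ?_)
  simpa using hC z

/-- Integration by parts along `exchangeDir i`: total derivatives have integral zero. -/
lemma integral_exchange {m₁ m₂ : ℝ} (h1 : 0 < m₁) (h2 : 0 < m₂) (s : ℤˣ)
    {i j : Fin 3} (hij : i ≠ j) {P P' : Mink × Mink → ℂ} (hP : P.HasTemperateGrowth)
    (hP' : P'.HasTemperateGrowth)
    (hd : ∀ z, HasDerivAt (fun t : ℝ => P (pairPoint m₁ m₂ s (z + t • exchangeDir i)))
      (P' (pairPoint m₁ m₂ s z)) 0) (h : 𝓢(Mink, ℂ)) :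
    ∫ z, h ((pairPoint m₁ m₂ s z).1 + (pairPoint m₁ m₂ s z).2) * P' (pairPoint m₁ m₂ s z) *
        (relVel m₁ m₂ j z : ℂ) =
      -∫ z, (h ((pairPoint m₁ m₂ s z).1 + (pairPoint m₁ m₂ s z).2) * P (pairPoint m₁ m₂ s z) *
          (relVelDeriv m₁ m₂ i j z : ℂ) +
        (∂_{(EuclideanSpace.single 0 1 : Mink)} h)
            ((pairPoint m₁ m₂ s z).1 + (pairPoint m₁ m₂ s z).2) *
          P (pairPoint m₁ m₂ s z) *
            ((((s : ℤ) : ℝ) * (relVel m₁ m₂ i z * relVel m₁ m₂ j z) : ℝ) : ℂ)) := by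
  set h0 : 𝓢(Mink, ℂ) := ∂_{(EuclideanSpace.single 0 1 : Mink)} h with hh0
  let f : E3 × E3 → ℂ := fun z => h ((pairPoint m₁ m₂ s z).1 + (pairPoint m₁ m₂ s z).2) *
    P (pairPoint m₁ m₂ s z) * (relVel m₁ m₂ j z : ℂ)
  have cv := continuous_relVel h1 h2
  have iA := integrable_pair_mul (m₁ := m₁) (m₂ := m₂) (s := s) hP' h (cv j)
    (abs_relVel_le m₁ m₂ j)
  have iB := integrable_pair_mul (m₁ := m₁) (m₂ := m₂) (s := s) hP h
    (continuous_relVelDeriv h1 h2 i j) (abs_relVelDeriv_le h1 h2 i j)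
  have iC := integrable_pair_mul (m₁ := m₁) (m₂ := m₂) (s := s) hP h0
    (b := fun z => ((s : ℤ) : ℝ) * (relVel m₁ m₂ i z * relVel m₁ m₂ j z))
    (continuous_const.mul ((cv i).mul (cv j))) (C := 1 * (2 * 2)) (fun z => by
      rw [abs_mul, abs_mul]
      have hs : |((s : ℤ) : ℝ)| = 1 := by
        rcases Int.units_eq_one_or s with rfl | rfl <;> simp
      rw [hs]
      gcongr
      · exact abs_relVel_le m₁ m₂ i z
      · exact abs_relVel_le m₁ m₂ j z)
  have iF : Integrable f := integrable_pair_mul hP h (cv j) (abs_relVel_le m₁ m₂ j)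
  have hder : ∀ z, HasLineDerivAt ℝ f
      (h ((pairPoint m₁ m₂ s z).1 + (pairPoint m₁ m₂ s z).2) * P' (pairPoint m₁ m₂ s z) *
        (relVel m₁ m₂ j z : ℂ) +
      (h ((pairPoint m₁ m₂ s z).1 + (pairPoint m₁ m₂ s z).2) * P (pairPoint m₁ m₂ s z) *
          (relVelDeriv m₁ m₂ i j z : ℂ) +
        h0 ((pairPoint m₁ m₂ s z).1 + (pairPoint m₁ m₂ s z).2) * P (pairPoint m₁ m₂ s z) *
            ((((s : ℤ) : ℝ) * (relVel m₁ m₂ i z * relVel m₁ m₂ j z) : ℝ) : ℂ)))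
      z (exchangeDir i) := by
    intro z
    have hk := hasDerivAt_total h1 h2 s i z
    have hhd : HasDerivAt (fun t : ℝ => h ((pairPoint m₁ m₂ s (z + t • exchangeDir i)).1 +
        (pairPoint m₁ m₂ s (z + t • exchangeDir i)).2))
        ((((s : ℤ) : ℝ) * relVel m₁ m₂ i z : ℝ) *
          h0 ((pairPoint m₁ m₂ s z).1 + (pairPoint m₁ m₂ s z).2)) 0 := by
      have hF := (h.differentiableAt (x := (pairPoint m₁ m₂ s z).1 +
        (pairPoint m₁ m₂ s z).2)).hasFDerivAt
      have := HasFDerivAt.comp_hasDerivAt_of_eq (0 : ℝ) hF hk (by simp)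
      refine this.congr_deriv ?_
      rw [hh0, SchwartzMap.lineDerivOp_apply_eq_fderiv, map_smul, Complex.real_smul]
    refine ((hhd.mul (hd z)).mul (hasDerivAt_relVel h1 h2 hij z).ofReal_comp).congr_deriv ?_
    simp only [zero_smul, add_zero, Pi.mul_apply]
    push_cast
    ring
  have : (volume : Measure (E3 × E3)).IsAddHaarMeasure :=
    inferInstanceAs ((volume : Measure E3).prod (volume : Measure E3)).IsAddHaarMeasure
  refine eq_neg_iff_add_eq_zero.2 ((integral_add iA (iB.add iC)).symm.trans ?_)
  have := integral_bilinear_hasLineDerivAt_right_eq_neg_left_of_integrable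
    (μ := (volume : Measure (E3 × E3))) (B := ContinuousLinearMap.mul ℝ ℂ)
    (f := fun _ => (1 : ℂ)) (f' := fun _ => 0) (g := f) (v := exchangeDir i)
    (by simp) ?_ (by simpa using iF)
    (fun z _ => hasDerivAt_const (0 : ℝ) (1 : ℂ))
    (fun z _ => hder z)
  · simpa only [ContinuousLinearMap.mul_apply', one_mul, zero_mul, integral_zero, neg_zero,
      Pi.add_apply] using this
  · simp only [ContinuousLinearMap.mul_apply', one_mul]
    exact iA.add (iB.add iC)

/-- The component `X^{0j}` of `X^{μν} = k^μ p^ν - k^ν p^μ = q^μ p^ν - q^ν p^μ`. -/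
def boostWedge (j : Fin 3) (w : Mink × Mink) : ℂ :=
  (w.2 0 : ℂ) * (w.1 j.succ : ℂ) - (w.1 0 : ℂ) * (w.2 j.succ : ℂ)

lemma hasTemperateGrowth_fst (μ : Fin 4) :
    (fun w : Mink × Mink => ((w.1 μ : ℝ) : ℂ)).HasTemperateGrowth :=
  (hasTemperateGrowth_coord μ).comp (ContinuousLinearMap.fst ℝ Mink Mink).hasTemperateGrowth

lemma hasTemperateGrowth_snd (μ : Fin 4) :
    (fun w : Mink × Mink => ((w.2 μ : ℝ) : ℂ)).HasTemperateGrowth :=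
  (hasTemperateGrowth_coord μ).comp (ContinuousLinearMap.snd ℝ Mink Mink).hasTemperateGrowth

lemma hasTemperateGrowth_boostWedge (j : Fin 3) : (boostWedge j).HasTemperateGrowth :=
  ((hasTemperateGrowth_snd 0).mul (hasTemperateGrowth_fst j.succ)).sub
    ((hasTemperateGrowth_fst 0).mul (hasTemperateGrowth_snd j.succ))

/-- Lorentz invariance of the two-particle measure at fixed total momentum, in infinitesimal form:
the curl in the directions `i`, `j` of `P` times the gradient of the energy integrates to zero
against functions of the total momentum. Here `Pi` and `Pj` are the derivatives of `P` along
`exchangeDir i` and `exchangeDir j`. -/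
lemma isNull_curl {m₁ m₂ : ℝ} (h1 : 0 < m₁) (h2 : 0 < m₂) (s : ℤˣ) {i j : Fin 3} (hij : i ≠ j)
    {P Pi Pj : Mink × Mink → ℂ} (hP : P.HasTemperateGrowth)
    (hPi : Pi.HasTemperateGrowth) (hPj : Pj.HasTemperateGrowth)
    (hdi : ∀ z, HasDerivAt (fun t : ℝ => P (pairPoint m₁ m₂ s (z + t • exchangeDir i)))
      (Pi (pairPoint m₁ m₂ s z)) 0)
    (hdj : ∀ z, HasDerivAt (fun t : ℝ => P (pairPoint m₁ m₂ s (z + t • exchangeDir j)))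
      (Pj (pairPoint m₁ m₂ s z)) 0) :
    IsNull m₁ m₂ s fun w => Pi w * boostWedge j w - Pj w * boostWedge i w := by
  intro h
  refine ⟨integrable_pairFun m₁ m₂ s ((hPi.mul (hasTemperateGrowth_boostWedge j)).sub
    (hPj.mul (hasTemperateGrowth_boostWedge i))) h, ?_⟩
  have cv := continuous_relVel h1 h2
  have ei := integral_exchange h1 h2 s hij hP hPi hdi h
  have ej := integral_exchange h1 h2 s hij.symm hP hPj hdj h
  have key : ∀ z, pairFun m₁ m₂ s (fun w => Pi w * boostWedge j w - Pj w * boostWedge i w) h z =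
      ((s : ℤ) : ℂ) / 4 * (h ((pairPoint m₁ m₂ s z).1 + (pairPoint m₁ m₂ s z).2) *
        Pi (pairPoint m₁ m₂ s z) * (relVel m₁ m₂ j z : ℂ) -
        h ((pairPoint m₁ m₂ s z).1 + (pairPoint m₁ m₂ s z).2) *
        Pj (pairPoint m₁ m₂ s z) * (relVel m₁ m₂ i z : ℂ)) := by
    intro z
    have hw : ∀ j, (pairWeight m₁ m₂ z : ℂ) * boostWedge j (pairPoint m₁ m₂ s z) =
        ((s : ℤ) : ℂ) / 4 * (relVel m₁ m₂ j z : ℂ) := by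
      intro j
      have p1 : (energy m₁ z.1 : ℂ) ≠ 0 := by exact_mod_cast (energy_pos h1 z.1).ne'
      have p2 : (energy m₂ z.2 : ℂ) ≠ 0 := by exact_mod_cast (energy_pos h2 z.2).ne'
      simp only [pairWeight, weight, boostWedge, pairPoint, shellPoint_zero, shellPoint_succ,
        relVel]
      push_cast
      field_simp
      ring
    rw [pairFun]
    linear_combination (h ((pairPoint m₁ m₂ s z).1 + (pairPoint m₁ m₂ s z).2)) *
      (Pi (pairPoint m₁ m₂ s z) * hw j - Pj (pairPoint m₁ m₂ s z) * hw i)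
  simp only [key]
  rw [integral_const_mul]
  -- the terms with second derivatives of the energy are symmetric in `i`, `j` and cancel
  rw [integral_sub (integrable_pair_mul hPi h (cv j) (abs_relVel_le m₁ m₂ j))
    (integrable_pair_mul hPj h (cv i) (abs_relVel_le m₁ m₂ i)), ei, ej]
  have hsymm : ∀ z, relVelDeriv m₁ m₂ j i z = relVelDeriv m₁ m₂ i j z := fun z => by
    simp only [relVelDeriv]; ring
  simp only [hsymm, mul_comm (relVel m₁ m₂ j _) (relVel m₁ m₂ i _), sub_self, mul_zero]

section

/-! ### Null amplitudes -/

section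

variable {m₁ m₂ : ℝ} {s : ℤˣ} {P Q : Mink × Mink → ℂ}

/-- Only the values of an amplitude on the mass shells matter. -/
lemma IsNull.congr (hP : IsNull m₁ m₂ s P)
    (h : ∀ z, P (pairPoint m₁ m₂ s z) = Q (pairPoint m₁ m₂ s z)) : IsNull m₁ m₂ s Q := by
  intro f
  have e : pairFun m₁ m₂ s Q f = pairFun m₁ m₂ s P f := by
    funext z
    simp only [pairFun, h]
  rw [e]
  exact hP f

lemma IsNull.add (hP : IsNull m₁ m₂ s P) (hQ : IsNull m₁ m₂ s Q) :
    IsNull m₁ m₂ s fun w => P w + Q w := by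
  intro f
  have e : pairFun m₁ m₂ s (fun w => P w + Q w) f =
      fun z => pairFun m₁ m₂ s P f z + pairFun m₁ m₂ s Q f z := by
    funext z
    simp only [pairFun]
    ring
  rw [e]
  exact ⟨(hP f).1.add (hQ f).1, by rw [integral_add (hP f).1 (hQ f).1, (hP f).2, (hQ f).2, add_zero]⟩

/-- Functions of the total momentum can be absorbed in the test function. -/
lemma IsNull.mul_total (hP : IsNull m₁ m₂ s P) {χ : Mink → ℂ} (hχ : χ.HasTemperateGrowth) :
    IsNull m₁ m₂ s fun w => χ (w.1 + w.2) * P w := by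
  intro f
  have e : pairFun m₁ m₂ s (fun w => χ (w.1 + w.2) * P w) f =
      pairFun m₁ m₂ s P (SchwartzMap.smulLeftCLM ℂ χ f) := by
    funext z
    simp only [pairFun, SchwartzMap.smulLeftCLM_apply_apply hχ, smul_eq_mul]
    ring
  rw [e]
  exact hP _

lemma IsNull.const_mul (hP : IsNull m₁ m₂ s P) (c : ℂ) : IsNull m₁ m₂ s fun w => c * P w :=
  hP.mul_total (χ := fun _ => c) (.const c)

lemma IsNull.sub (hP : IsNull m₁ m₂ s P) (hQ : IsNull m₁ m₂ s Q) :
    IsNull m₁ m₂ s fun w => P w - Q w :=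
  (hP.add (hQ.const_mul (-1))).congr fun z => by ring

lemma IsNull.sum {ι : Type*} (t : Finset ι) {F : ι → Mink × Mink → ℂ}
    (h : ∀ i ∈ t, IsNull m₁ m₂ s (F i)) : IsNull m₁ m₂ s fun w => ∑ i ∈ t, F i w := by
  classical
  induction t using Finset.induction_on with
  | empty =>
    intro f
    have e : pairFun m₁ m₂ s (fun w => ∑ i ∈ (∅ : Finset ι), F i w) f = fun _ => 0 := by
      funext z; simp [pairFun]
    rw [e]
    simp
  | insert a t ha ih =>
    simp only [Finset.sum_insert ha]
    exact (h a (Finset.mem_insert_self _ _)).add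
      (ih fun i hi => h i (Finset.mem_insert_of_mem hi))

lemma tendsto_shellPoint {m : ℕ → ℝ} {m₀ : ℝ} (h : Tendsto m atTop (𝓝 m₀)) (s : ℤˣ) (p : E3) :
    Tendsto (fun n => shellPoint (m n) s p) atTop (𝓝 (shellPoint m₀ s p)) := by
  have hc : Continuous fun m : ℝ => shellPoint m s p := by
    unfold shellPoint
    refine (PiLp.continuous_toLp 2 _).comp (continuous_pi fun i => ?_)
    refine Fin.cases ?_ (fun j => ?_) i
    · simp only [Fin.cons_zero, energy]; fun_prop
    · simp only [Fin.cons_succ]; fun_prop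
  exact (hc.tendsto _).comp h

lemma tendsto_weight {m : ℕ → ℝ} {m₀ : ℝ} (h : Tendsto m atTop (𝓝 m₀)) {p : E3} (hp : p ≠ 0) :
    Tendsto (fun n => weight (m n) p) atTop (𝓝 (weight m₀ p)) := by
  have hc : Continuous fun m : ℝ => 2 * energy m p := by unfold energy; fun_prop
  have h0 : 2 * energy m₀ p ≠ 0 := by
    have := norm_le_energy m₀ p
    have := norm_pos_iff.2 hp
    exact ne_of_gt (by linarith)
  exact ((hc.tendsto _).comp h).inv₀ h0

/-- Two-particle integrals depend continuously on the masses, down to mass zero. -/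
lemma IsNull.of_tendsto {a b : ℕ → ℝ} (ha : Tendsto a atTop (𝓝 m₁)) (hb : Tendsto b atTop (𝓝 m₂))
    (hP : P.HasTemperateGrowth) (h : ∀ n, IsNull (a n) (b n) s P) : IsNull m₁ m₂ s P := by
  intro f
  refine ⟨integrable_pairFun m₁ m₂ s hP f, ?_⟩
  obtain ⟨C, N, -, hC⟩ := exists_majorant_pairFun hP
  have hlim := tendsto_integral_of_dominated_convergence (μ := (volume : Measure (E3 × E3)))
    (F := fun n => pairFun (a n) (b n) s P f) (f := pairFun m₁ m₂ s P f)
    (fun z => C * (Finset.Iic N).sup (schwartzSeminormFamily ℂ Mink ℂ) f * pairMajorant z)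
    (fun n => (h n f).1.aestronglyMeasurable) (integrable_pairMajorant.const_mul _)
    (fun n => hC f (a n) (b n) s) (by
      filter_upwards [ae_ne_zero] with z hz
      have h1 := tendsto_shellPoint ha s z.1
      have h2 := tendsto_shellPoint hb s z.2
      have h3 : Tendsto (fun n => pairPoint (a n) (b n) s z) atTop (𝓝 (pairPoint m₁ m₂ s z)) :=
        h1.prodMk_nhds h2
      have h4 := ((tendsto_weight ha hz.1).mul (tendsto_weight hb hz.2)).ofReal
      exact h4.mul (((f.continuous.tendsto _).comp (h1.add h2)).mul
        ((hP.1.continuous.tendsto _).comp h3)))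
  simp only [(h _ f).2] at hlim
  exact tendsto_nhds_unique hlim tendsto_const_nhds

end

lemma IsNull.of_pos {P : Mink × Mink → ℂ} (hP : P.HasTemperateGrowth) {s : ℤˣ}
    (h : ∀ m₁ m₂ : ℝ, 0 < m₁ → 0 < m₂ → IsNull m₁ m₂ s P) {m₁ m₂ : ℝ} (h1 : 0 ≤ m₁)
    (h2 : 0 ≤ m₂) : IsNull m₁ m₂ s P := by
  have ht : ∀ m : ℝ, Tendsto (fun n : ℕ => m + 1 / ((n : ℝ) + 1)) atTop (𝓝 m) := fun m => by
    simpa using tendsto_one_div_add_atTop_nhds_zero_nat.const_add m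
  exact IsNull.of_tendsto (ht m₁) (ht m₂) hP fun n => h _ _ (by positivity) (by positivity)

/-! ### Moments of the momentum at fixed total momentum -/

lemma hasDerivAt_coord_self (m₁ m₂ : ℝ) (s : ℤˣ) (i : Fin 3) (z : E3 × E3) :
    HasDerivAt (fun t : ℝ => (((pairPoint m₁ m₂ s (z + t • exchangeDir i)).1 i.succ : ℝ) : ℂ))
      1 0 := by
  have h : (fun t : ℝ => (pairPoint m₁ m₂ s (z + t • exchangeDir i)).1 i.succ) =
      fun t => z.1 i + t := by
    funext t
    simp [pairPoint, exchangeDir]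
  have := ((hasDerivAt_id (0 : ℝ)).const_add (z.1 i)).ofReal_comp
  rw [Complex.ofReal_one] at this
  exact this.congr_of_eventuallyEq
    (Eventually.of_forall fun t => congrArg Complex.ofReal (congrFun h t))

lemma hasDerivAt_coord_of_ne (m₁ m₂ : ℝ) (s : ℤˣ) {i l : Fin 3} (hl : l ≠ i) (z : E3 × E3) :
    HasDerivAt (fun t : ℝ => (((pairPoint m₁ m₂ s (z + t • exchangeDir i)).1 l.succ : ℝ) : ℂ))
      0 0 := by
  have h : (fun t : ℝ => (((pairPoint m₁ m₂ s (z + t • exchangeDir i)).1 l.succ : ℝ) : ℂ)) =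
      fun t => (z.1 l : ℂ) := by
    funext t
    simp [pairPoint, exchangeDir, hl]
  rw [h]
  exact hasDerivAt_const _ _

variable {m₁ m₂ : ℝ}

lemma isNull_boostWedge (h1 : 0 ≤ m₁) (h2 : 0 ≤ m₂) (s : ℤˣ) (j : Fin 3) :
    IsNull m₁ m₂ s (boostWedge j) := by
  obtain ⟨i, hij⟩ := exists_ne j
  refine IsNull.of_pos (hasTemperateGrowth_boostWedge j) (fun a b ha hb => ?_) h1 h2
  refine (isNull_curl ha hb s hij (P := fun w => ((w.1 i.succ : ℝ) : ℂ))
    (Pi := fun _ => 1) (Pj := fun _ => 0) (hasTemperateGrowth_fst _) (.const _) (.const _)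
    (hasDerivAt_coord_self a b s i) (hasDerivAt_coord_of_ne a b s hij)).congr fun z => by ring

lemma isNull_mul_boostWedge_of_ne (h1 : 0 ≤ m₁) (h2 : 0 ≤ m₂) (s : ℤˣ) {l j : Fin 3} (hlj : l ≠ j) :
    IsNull m₁ m₂ s fun w => (w.1 l.succ : ℂ) * boostWedge j w := by
  refine IsNull.of_pos ((hasTemperateGrowth_fst _).mul (hasTemperateGrowth_boostWedge j))
    (fun a b ha hb => ?_) h1 h2
  have := isNull_curl ha hb s hlj (P := fun w => (w.1 l.succ : ℂ) * (w.1 l.succ : ℂ))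
    (Pi := fun w => 1 * (w.1 l.succ : ℂ) + (w.1 l.succ : ℂ) * 1)
    (Pj := fun w => 0 * (w.1 l.succ : ℂ) + (w.1 l.succ : ℂ) * 0)
    ((hasTemperateGrowth_fst _).mul (hasTemperateGrowth_fst _))
    (((Function.HasTemperateGrowth.const _).mul (hasTemperateGrowth_fst _)).add
      ((hasTemperateGrowth_fst _).mul (.const _)))
    (((Function.HasTemperateGrowth.const _).mul (hasTemperateGrowth_fst _)).add
      ((hasTemperateGrowth_fst _).mul (.const _)))
    (fun z => ((hasDerivAt_coord_self a b s l z).mul (hasDerivAt_coord_self a b s l z)).congr_deriv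
      (by simp))
    (fun z => ((hasDerivAt_coord_of_ne a b s hlj z).mul
      (hasDerivAt_coord_of_ne a b s hlj z)).congr_deriv (by simp))
  exact (this.const_mul (1 / 2)).congr fun z => by simp only [Pi.mul_apply]; ring

lemma isNull_mul_boostWedge_sub (h1 : 0 ≤ m₁) (h2 : 0 ≤ m₂) (s : ℤˣ) (i j : Fin 3) :
    IsNull m₁ m₂ s fun w => (w.1 j.succ : ℂ) * boostWedge j w - (w.1 i.succ : ℂ) * boostWedge i w := by
  rcases eq_or_ne i j with rfl | hij
  · exact ((isNull_boostWedge h1 h2 s i).const_mul 0).congr fun z => by ring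
  refine IsNull.of_pos (((hasTemperateGrowth_fst _).mul (hasTemperateGrowth_boostWedge j)).sub
    ((hasTemperateGrowth_fst _).mul (hasTemperateGrowth_boostWedge i)))
    (fun a b ha hb => ?_) h1 h2
  have := isNull_curl ha hb s hij (P := fun w => (w.1 i.succ : ℂ) * (w.1 j.succ : ℂ))
    (Pi := fun w => (w.1 j.succ : ℂ)) (Pj := fun w => (w.1 i.succ : ℂ))
    ((hasTemperateGrowth_fst _).mul (hasTemperateGrowth_fst _))
    (hasTemperateGrowth_fst _) (hasTemperateGrowth_fst _)
    (fun z => ((hasDerivAt_coord_self a b s i z).mul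
      (hasDerivAt_coord_of_ne a b s hij.symm z)).congr_deriv (by simp))
    (fun z => ((hasDerivAt_coord_of_ne a b s hij z).mul
      (hasDerivAt_coord_self a b s j z)).congr_deriv (by simp))
  exact this

end

/-! ### Smooth inverses -/

/-- A smooth function that vanishes for `t ≤ c / 2` and equals `1 / t` for `t ≥ c`. -/
def cutoffInv (c t : ℝ) : ℝ := Real.smoothTransition (2 * t / c - 1) * t⁻¹

lemma cutoffInv_of_le {c t : ℝ} (hc : 0 < c) (h : c ≤ t) : cutoffInv c t = t⁻¹ := by
  rw [cutoffInv, Real.smoothTransition.one_of_one_le, one_mul]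
  rw [le_sub_iff_add_le, le_div_iff₀ hc]
  linarith

lemma cutoffInv_of_ge {c t : ℝ} (hc : 0 < c) (h : t ≤ c / 2) : cutoffInv c t = 0 := by
  rw [cutoffInv, Real.smoothTransition.zero_of_nonpos, zero_mul]
  rw [sub_nonpos, div_le_one hc]
  linarith

lemma abs_cutoffInv_mul_le (c t : ℝ) : |cutoffInv c t * t| ≤ 1 := by
  have h0 := Real.smoothTransition.nonneg (2 * t / c - 1)
  have h1 := Real.smoothTransition.le_one (2 * t / c - 1)
  rcases eq_or_ne t 0 with rfl | ht
  · simp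
  · rw [cutoffInv, inv_mul_cancel_right₀ ht, abs_of_nonneg h0]
    exact h1

lemma contDiff_cutoffInv {c : ℝ} (hc : 0 < c) {n : WithTop ℕ∞} (hn : n ≤ (⊤ : ℕ∞)) :
    ContDiff ℝ n (cutoffInv c) := by
  refine ContDiff.of_le ?_ hn
  rw [contDiff_iff_contDiffAt]
  intro t
  rcases lt_or_ge t (c / 2) with ht | ht
  · refine (contDiffAt_const (c := (0 : ℝ))).congr_of_eventuallyEq ?_
    filter_upwards [eventually_lt_nhds ht] with x hx
    exact cutoffInv_of_ge hc hx.le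
  · have h0 : t ≠ 0 := by linarith
    refine ContDiffAt.mul ?_ (contDiffAt_inv ℝ h0)
    exact (Real.smoothTransition.contDiff.comp (by fun_prop)).contDiffAt

lemma hasTemperateGrowth_cutoffInv {c : ℝ} (hc : 0 < c) : (cutoffInv c).HasTemperateGrowth := by
  refine ⟨contDiff_cutoffInv hc le_rfl, fun n => ?_⟩
  -- the derivatives are bounded: they vanish on the left, are those of `1 / t` on the right, and
  -- are continuous on the compact interval in between
  obtain ⟨K, hK⟩ := (isCompact_Icc (a := c / 2) (b := c)).exists_bound_of_continuousOn
    ((contDiff_cutoffInv hc (n := n) (by exact_mod_cast le_top)).continuous_iteratedFDeriv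
      le_rfl).continuousOn
  refine ⟨0, max 0 K + n.factorial * (c⁻¹) ^ (n + 1), fun t => ?_⟩
  rw [pow_zero, mul_one]
  have hp : 0 ≤ n.factorial * (c⁻¹) ^ (n + 1) := by positivity
  have hm : 0 ≤ max 0 K := le_max_left _ _
  rcases lt_or_ge t (c / 2) with h1 | h1
  · have e : cutoffInv c =ᶠ[𝓝 t] fun _ => (0 : ℝ) := by
      filter_upwards [eventually_lt_nhds h1] with x hx
      exact cutoffInv_of_ge hc hx.le
    rw [(e.iteratedFDeriv ℝ n).eq_of_nhds]
    simp only [iteratedFDeriv_fun_zero, Pi.zero_apply, norm_zero]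
    positivity
  rcases le_or_gt t c with h2 | h2
  · have := hK t ⟨h1, h2⟩
    have := le_max_right 0 K
    linarith
  · have e : cutoffInv c =ᶠ[𝓝 t] fun x => x⁻¹ := by
      filter_upwards [eventually_gt_nhds h2] with x hx
      exact cutoffInv_of_le hc hx.le
    rw [(e.iteratedFDeriv ℝ n).eq_of_nhds, norm_iteratedFDeriv_eq_norm_iteratedDeriv,
      iteratedDeriv_eq_iterate, iter_deriv_inv]
    have ht : 0 < t := hc.trans h2
    have h3 : t ^ (-1 - n : ℤ) = (t⁻¹) ^ (n + 1) := by
      rw [show (-1 - n : ℤ) = -((n + 1 : ℕ) : ℤ) by push_cast; ring, zpow_neg, zpow_natCast,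
        inv_pow]
    have h4 : (t⁻¹) ^ (n + 1) ≤ (c⁻¹) ^ (n + 1) :=
      pow_le_pow_left₀ (by positivity) (inv_anti₀ hc h2.le) _
    rw [h3, norm_mul, norm_mul, norm_pow, norm_neg, norm_one, one_pow, one_mul,
      Real.norm_of_nonneg (by positivity), Real.norm_of_nonneg (by positivity)]
    have : (n.factorial : ℝ) * (t⁻¹) ^ (n + 1) ≤ n.factorial * (c⁻¹) ^ (n + 1) := by gcongr
    linarith

lemma hasTemperateGrowth_cutoffInv_comp {c : ℝ} (hc : 0 < c) {w : Mink → ℝ}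
    (hw : w.HasTemperateGrowth) : (fun k => (cutoffInv c (w k) : ℂ)).HasTemperateGrowth :=
  Complex.ofRealCLM.hasTemperateGrowth.comp ((hasTemperateGrowth_cutoffInv hc).comp hw)

/-- A factor that depends on the total momentum only can be cancelled if it is positive almost
everywhere. -/
lemma IsNull.of_mul_total {m₁ m₂ : ℝ} {s : ℤˣ} {P : Mink × Mink → ℂ} (hP : P.HasTemperateGrowth)
    {w : Mink → ℝ} (hw : w.HasTemperateGrowth)
    (hpos : ∀ᵐ z, 0 < w ((pairPoint m₁ m₂ s z).1 + (pairPoint m₁ m₂ s z).2))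
    (h : IsNull m₁ m₂ s fun z => (w (z.1 + z.2) : ℂ) * P z) : IsNull m₁ m₂ s P := by
  intro f
  have hI := integrable_pairFun m₁ m₂ s hP f
  refine ⟨hI, ?_⟩
  have hc : ∀ n : ℕ, 0 < 1 / ((n : ℝ) + 1) := fun n => by positivity
  have hN := fun n : ℕ => h.mul_total (hasTemperateGrowth_cutoffInv_comp (hc n) hw) f
  have key : ∀ (n : ℕ) z, pairFun m₁ m₂ s (fun z => (cutoffInv (1 / ((n : ℝ) + 1)) (w (z.1 + z.2)) : ℂ)
      * ((w (z.1 + z.2) : ℂ) * P z)) f z =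
      ((cutoffInv (1 / ((n : ℝ) + 1)) (w ((pairPoint m₁ m₂ s z).1 + (pairPoint m₁ m₂ s z).2)) *
        w ((pairPoint m₁ m₂ s z).1 + (pairPoint m₁ m₂ s z).2) : ℝ) : ℂ) *
        pairFun m₁ m₂ s P f z := by
    intro n z
    simp only [pairFun]
    push_cast
    ring
  have hlim := tendsto_integral_of_dominated_convergence (μ := (volume : Measure (E3 × E3)))
    (f := pairFun m₁ m₂ s P f) (fun z => ‖pairFun m₁ m₂ s P f z‖)
    (fun n => (hN n).1.aestronglyMeasurable) hI.norm
    (fun n => Eventually.of_forall fun z => by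
      rw [key, norm_mul, Complex.norm_real, Real.norm_eq_abs]
      exact mul_le_of_le_one_left (norm_nonneg _) (abs_cutoffInv_mul_le _ _)) (by
      filter_upwards [hpos] with z hz
      refine tendsto_const_nhds.congr' ?_
      have h1 := (tendsto_order.1 tendsto_one_div_add_atTop_nhds_zero_nat).2 _ hz
      filter_upwards [h1] with n hn
      rw [key, cutoffInv_of_le (hc n) hn.le, inv_mul_cancel₀ hz.ne', Complex.ofReal_one, one_mul])
  simp only [fun n => (hN n).2] at hlim
  exact tendsto_nhds_unique hlim tendsto_const_nhds

/-! ### The total momentum is time-like -/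

lemma mdot_shellPoint_self (m : ℝ) (s : ℤˣ) (p : E3) :
    mdot (shellPoint m s p) (shellPoint m s p) = m ^ 2 := by
  have h0 := energy_sq m p
  have h1 := norm_sq_eq p
  have h2 := sign_sq s
  have e1 : shellPoint m s p 1 = p 0 := rfl
  have e2 : shellPoint m s p 2 = p 1 := rfl
  have e3 : shellPoint m s p 3 = p 2 := rfl
  rw [mdot_eq, shellPoint_zero, e1, e2, e3]
  linear_combination (energy m p) ^ 2 * h2 + h0 + h1

lemma mdot_shellPoint_shellPoint (m₁ m₂ : ℝ) (s : ℤˣ) (p q : E3) :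
    mdot (shellPoint m₁ s p) (shellPoint m₂ s q) =
      energy m₁ p * energy m₂ q - inner ℝ p q := by
  have h2 := sign_sq s
  have e1 : ∀ m p, shellPoint m s p 1 = p 0 := fun _ _ => rfl
  have e2 : ∀ m p, shellPoint m s p 2 = p 1 := fun _ _ => rfl
  have e3 : ∀ m p, shellPoint m s p 3 = p 2 := fun _ _ => rfl
  rw [mdot_eq, shellPoint_zero, shellPoint_zero, e1, e2, e3, e1, e2, e3, PiLp.inner_apply]
  simp only [Fin.sum_univ_three, RCLike.inner_apply, conj_trivial]
  linear_combination energy m₁ p * energy m₂ q * h2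

lemma mdot_total (m₁ m₂ : ℝ) (s : ℤˣ) (z : E3 × E3) :
    mdot ((pairPoint m₁ m₂ s z).1 + (pairPoint m₁ m₂ s z).2)
      ((pairPoint m₁ m₂ s z).1 + (pairPoint m₁ m₂ s z).2) =
      m₁ ^ 2 + m₂ ^ 2 + 2 * (energy m₁ z.1 * energy m₂ z.2 - inner ℝ z.1 z.2) := by
  have h1 := mdot_shellPoint_self m₁ s z.1
  have h2 := mdot_shellPoint_self m₂ s z.2
  have h3 := mdot_shellPoint_shellPoint m₁ m₂ s z.1 z.2
  simp only [mdot_eq] at h1 h2 h3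
  simp only [mdot_eq, pairPoint, PiLp.add_apply]
  linear_combination h1 + h2 + 2 * h3

lemma sq_add_le_mdot_total (m₁ m₂ : ℝ) (s : ℤˣ) (z : E3 × E3) :
    (m₁ + m₂) ^ 2 ≤ mdot ((pairPoint m₁ m₂ s z).1 + (pairPoint m₁ m₂ s z).2)
      ((pairPoint m₁ m₂ s z).1 + (pairPoint m₁ m₂ s z).2) := by
  rw [mdot_total]
  have hcs := real_inner_le_norm z.1 z.2
  have h : m₁ * m₂ + ‖z.1‖ * ‖z.2‖ ≤ energy m₁ z.1 * energy m₂ z.2 := by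
    rw [energy, energy, ← Real.sqrt_mul (by positivity)]
    refine Real.le_sqrt_of_sq_le ?_
    nlinarith [sq_nonneg (m₁ * ‖z.2‖ - m₂ * ‖z.1‖)]
  nlinarith

/-- For almost all pairs of massless momenta, which are not parallel, the total momentum is
time-like. -/
lemma ae_mdot_total_pos (s : ℤˣ) : ∀ᵐ z, 0 < mdot ((pairPoint 0 0 s z).1 + (pairPoint 0 0 s z).2)
    ((pairPoint 0 0 s z).1 + (pairPoint 0 0 s z).2) := by
  have hmeas : MeasurableSet {z : E3 × E3 | 0 < mdot ((pairPoint 0 0 s z).1 + (pairPoint 0 0 s z).2)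
      ((pairPoint 0 0 s z).1 + (pairPoint 0 0 s z).2)} := by
    have h1 := continuous_pairPoint 0 0 s
    have h2 : Continuous fun k : Mink => mdot k k := by simp only [mdot_eq]; fun_prop
    exact measurableSet_lt measurable_const (h2.comp (h1.fst.add h1.snd)).measurable
  rw [Measure.volume_eq_prod, Measure.ae_prod_iff_ae_ae hmeas]
  filter_upwards [Measure.ae_ne volume (0 : E3)] with p hp
  have hspan : (Submodule.span ℝ {p} : Submodule ℝ E3) ≠ ⊤ := by
    intro h
    have h1 := finrank_span_singleton (K := ℝ) hp
    rw [h, finrank_top] at h1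
    simp at h1
  have hnull := Measure.addHaar_submodule volume (Submodule.span ℝ {p} : Submodule ℝ E3) hspan
  filter_upwards [measure_eq_zero_iff_ae_notMem.1 hnull] with q hq
  rw [mdot_total]
  have he : ∀ p, energy 0 p = ‖p‖ := fun p => by simp [energy, Real.sqrt_sq]
  have hlt : inner ℝ p q < ‖p‖ * ‖q‖ := by
    refine lt_of_le_of_ne (real_inner_le_norm p q) fun h => hq ?_
    have h2 := inner_eq_norm_mul_iff_real.1 h
    have hp0 : ‖p‖ ≠ 0 := norm_ne_zero_iff.2 hp
    refine Submodule.mem_span_singleton.2 ⟨‖p‖⁻¹ * ‖q‖, ?_⟩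
    rw [mul_smul, h2, smul_smul, inv_mul_cancel₀ hp0, one_smul]
  simp only [he]
  nlinarith

lemma ae_energy_total_pos (m₁ m₂ : ℝ) (s : ℤˣ) : ∀ᵐ z,
    0 < ((pairPoint m₁ m₂ s z).1 + (pairPoint m₁ m₂ s z).2) 0 ^ 2 := by
  filter_upwards [ae_ne_zero] with z hz
  have h1 := norm_le_energy m₁ z.1
  have h2 := energy_nonneg m₂ z.2
  have h3 := norm_pos_iff.2 hz.1
  simp only [pairPoint, PiLp.add_apply, shellPoint_zero, ← mul_add, mul_pow, sign_sq, one_mul]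
  have : 0 < energy m₁ z.1 + energy m₂ z.2 := by linarith
  positivity

section

/-! ### First and second moments -/

/-- `k · p` on the mass shells, as a function of `k = p + q`. -/
def shellDot (m₁ m₂ : ℝ) (k : Mink) : ℝ := (mdot k k + m₁ ^ 2 - m₂ ^ 2) / 2

lemma hasTemperateGrowth_coord_real (μ : Fin 4) : (fun p : Mink => (p μ : ℝ)).HasTemperateGrowth :=
  (EuclideanSpace.proj μ : EuclideanSpace ℝ (Fin 4) →L[ℝ] ℝ).hasTemperateGrowth

lemma hasTemperateGrowth_mdot_real : (fun k : Mink => mdot k k).HasTemperateGrowth := by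
  have h0 := hasTemperateGrowth_coord_real 0
  have h1 := hasTemperateGrowth_coord_real 1
  have h2 := hasTemperateGrowth_coord_real 2
  have h3 := hasTemperateGrowth_coord_real 3
  simp only [mdot_eq]
  fun_prop

lemma hasTemperateGrowth_mdot : (fun k : Mink => (mdot k k : ℂ)).HasTemperateGrowth :=
  Complex.ofRealCLM.hasTemperateGrowth.comp hasTemperateGrowth_mdot_real

lemma hasTemperateGrowth_shellDot (m₁ m₂ : ℝ) :
    (fun k : Mink => (shellDot m₁ m₂ k : ℂ)).HasTemperateGrowth := by
  have h := hasTemperateGrowth_mdot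
  unfold shellDot
  push_cast
  simp only [div_eq_mul_inv]
  fun_prop

lemma mdot_pair_fst (m₁ m₂ : ℝ) (s : ℤˣ) (z : E3 × E3) :
    ((pairPoint m₁ m₂ s z).1 0 : ℂ) ^ 2 - ((pairPoint m₁ m₂ s z).1 1 : ℂ) ^ 2 -
      ((pairPoint m₁ m₂ s z).1 2 : ℂ) ^ 2 - ((pairPoint m₁ m₂ s z).1 3 : ℂ) ^ 2 = (m₁ : ℂ) ^ 2 := by
  have h := mdot_shellPoint_self m₁ s z.1
  rw [mdot_eq] at h
  simp only [← pow_two] at h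
  exact_mod_cast h

lemma mdot_pair_snd (m₁ m₂ : ℝ) (s : ℤˣ) (z : E3 × E3) :
    ((pairPoint m₁ m₂ s z).2 0 : ℂ) ^ 2 - ((pairPoint m₁ m₂ s z).2 1 : ℂ) ^ 2 -
      ((pairPoint m₁ m₂ s z).2 2 : ℂ) ^ 2 - ((pairPoint m₁ m₂ s z).2 3 : ℂ) ^ 2 = (m₂ : ℂ) ^ 2 := by
  have h := mdot_shellPoint_self m₂ s z.2
  rw [mdot_eq] at h
  simp only [← pow_two] at h
  exact_mod_cast h

/-- The defect of the first moment: `k² p^μ - (k · p) k^μ`, which is `k²` times the part of `p`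
transverse to `k`. -/
def firstMoment (m₁ m₂ : ℝ) (μ : Fin 4) (w : Mink × Mink) : ℂ :=
  (mdot (w.1 + w.2) (w.1 + w.2) : ℂ) * (w.1 μ : ℂ) -
    (shellDot m₁ m₂ (w.1 + w.2) : ℂ) * ((w.1 + w.2) μ : ℂ)

/-- The defect of the second moment: `(k²)²` times the difference of `p^μ p^ν` and its mean at fixed
`k`, which is spanned by `k^μ k^ν` and `k^μ k^ν - η^{μν} k²`, with coefficients determined by
`k · p` and `p²`. -/
def secondMoment (m₁ m₂ : ℝ) (μ ν : Fin 4) (w : Mink × Mink) : ℂ :=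
  (mdot (w.1 + w.2) (w.1 + w.2) : ℂ) ^ 2 * ((w.1 μ : ℂ) * (w.1 ν : ℂ)) -
    ((shellDot m₁ m₂ (w.1 + w.2) : ℂ) ^ 2 * (((w.1 + w.2) μ : ℂ) * ((w.1 + w.2) ν : ℂ)) +
      1 / 3 * (((w.1 + w.2) μ : ℂ) * ((w.1 + w.2) ν : ℂ) -
        (eta μ ν : ℂ) * (mdot (w.1 + w.2) (w.1 + w.2) : ℂ)) *
      ((shellDot m₁ m₂ (w.1 + w.2) : ℂ) ^ 2 -
        (mdot (w.1 + w.2) (w.1 + w.2) : ℂ) * (m₁ : ℂ) ^ 2))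

lemma hasTemperateGrowth_firstMoment (m₁ m₂ : ℝ) (μ : Fin 4) :
    (firstMoment m₁ m₂ μ).HasTemperateGrowth :=
  ((hasTemperateGrowth_total hasTemperateGrowth_mdot).mul (hasTemperateGrowth_fst μ)).sub
    ((hasTemperateGrowth_total (hasTemperateGrowth_shellDot m₁ m₂)).mul
      (hasTemperateGrowth_total (hasTemperateGrowth_coord μ)))

lemma hasTemperateGrowth_secondMoment (m₁ m₂ : ℝ) (μ ν : Fin 4) :
    (secondMoment m₁ m₂ μ ν).HasTemperateGrowth := by
  have h1 := hasTemperateGrowth_total hasTemperateGrowth_mdot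
  have h2 := hasTemperateGrowth_total (hasTemperateGrowth_shellDot m₁ m₂)
  have h3 := hasTemperateGrowth_total (hasTemperateGrowth_coord μ)
  have h4 := hasTemperateGrowth_total (hasTemperateGrowth_coord ν)
  have h5 := hasTemperateGrowth_fst μ
  have h6 := hasTemperateGrowth_fst ν
  unfold secondMoment
  fun_prop

variable {m₁ m₂ : ℝ}

lemma isNull_firstMoment_zero (h1 : 0 ≤ m₁) (h2 : 0 ≤ m₂) (s : ℤˣ) :
    IsNull m₁ m₂ s (firstMoment m₁ m₂ 0) := by
  have h := IsNull.sum Finset.univ fun j (_ : j ∈ Finset.univ) =>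
    (isNull_boostWedge h1 h2 s j).mul_total (hasTemperateGrowth_coord j.succ)
  refine h.congr fun z => ?_
  have ha := mdot_pair_fst m₁ m₂ s z
  have hb := mdot_pair_snd m₁ m₂ s z
  simp only [Fin.sum_univ_three, boostWedge, firstMoment, shellDot, mdot_eq, PiLp.add_apply,
    Fin.reduceSucc, Fin.succ_zero_eq_one, Fin.succ_one_eq_two] at ha hb ⊢
  push_cast
  set w := pairPoint m₁ m₂ s z
  linear_combination ((w.1 0 : ℂ) + w.2 0) / 2 * (hb - ha)

/-- The mean of `p` at fixed total momentum `k` is parallel to `k`. -/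
lemma isNull_firstMoment (h1 : 0 ≤ m₁) (h2 : 0 ≤ m₂) (s : ℤˣ) (μ : Fin 4) :
    IsNull m₁ m₂ s (firstMoment m₁ m₂ μ) := by
  refine Fin.cases (isNull_firstMoment_zero h1 h2 s) (fun j => ?_) μ
  -- only the multiple by `k⁰` is a combination of known null amplitudes
  refine IsNull.of_mul_total (hasTemperateGrowth_firstMoment _ _ _)
    (w := fun k => k 0 ^ 2) ((hasTemperateGrowth_coord_real 0).pow 2)
    (ae_energy_total_pos m₁ m₂ s) ?_
  have h := (((isNull_boostWedge h1 h2 s j).mul_total hasTemperateGrowth_mdot).add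
    ((isNull_firstMoment_zero h1 h2 s).mul_total (hasTemperateGrowth_coord j.succ))).mul_total
    (hasTemperateGrowth_coord 0)
  refine h.congr fun z => ?_
  simp only [boostWedge, firstMoment, PiLp.add_apply]
  push_cast
  ring

/-- The mean of `p^l` times `k⁰ p^j - k^j p⁰` at fixed total momentum is isotropic. -/
lemma isNull_mul_boostWedge (h1 : 0 ≤ m₁) (h2 : 0 ≤ m₂) (s : ℤˣ) (l j : Fin 3) :
    IsNull m₁ m₂ s fun w => (w.1 l.succ : ℂ) * boostWedge j w - (if l = j then 1 else 0) *
      (((shellDot m₁ m₂ (w.1 + w.2) : ℂ) * (w.1 0 : ℂ)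
        - ((w.1 + w.2) 0 : ℂ) * (m₁ : ℂ) ^ 2) / 3) := by
  rcases eq_or_ne l j with rfl | hlj
  · -- the three diagonal terms have the same mean, and their sum is fixed by the mass shell
    have h := (IsNull.sum Finset.univ fun i (_ : i ∈ Finset.univ) =>
      isNull_mul_boostWedge_sub h1 h2 s i l).const_mul (1 / 3)
    refine h.congr fun z => ?_
    have ha := mdot_pair_fst m₁ m₂ s z
    have hb := mdot_pair_snd m₁ m₂ s z
    rw [Finset.sum_sub_distrib, Finset.sum_const, Finset.card_univ, Fintype.card_fin]
    simp only [Fin.sum_univ_three, boostWedge, shellDot, mdot_eq, PiLp.add_apply,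
      Fin.reduceSucc, Fin.succ_zero_eq_one, Fin.succ_one_eq_two, if_true] at ha hb ⊢
    push_cast
    set w := pairPoint m₁ m₂ s z
    linear_combination ((w.2 0 : ℂ) / 3 + (w.1 0 : ℂ) / 6) * ha + (w.1 0 : ℂ) / 6 * hb
  · refine (isNull_mul_boostWedge_of_ne h1 h2 s hlj).congr fun z => ?_
    rw [if_neg hlj]
    ring

lemma isNull_secondMoment_zero_succ (h1 : 0 ≤ m₁) (h2 : 0 ≤ m₂) (s : ℤˣ) (l : Fin 3) :
    IsNull m₁ m₂ s (secondMoment m₁ m₂ 0 l.succ) := by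
  have hκ := hasTemperateGrowth_shellDot m₁ m₂
  have h := IsNull.sum Finset.univ fun j (_ : j ∈ Finset.univ) =>
    (isNull_mul_boostWedge h1 h2 s l j).mul_total (hasTemperateGrowth_coord j.succ)
  have h' : IsNull m₁ m₂ s fun w => (mdot (w.1 + w.2) (w.1 + w.2) : ℂ) * ((w.1 0 : ℂ) *
      (w.1 l.succ : ℂ)) - ((w.1 + w.2) l.succ : ℂ) * (((shellDot m₁ m₂ (w.1 + w.2) : ℂ) *
      (w.1 0 : ℂ) - ((w.1 + w.2) 0 : ℂ) * (m₁ : ℂ) ^ 2) / 3) -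
      ((w.1 + w.2) 0 : ℂ) * ((shellDot m₁ m₂ (w.1 + w.2) : ℂ) * (w.1 l.succ : ℂ)) := by
    refine h.congr fun z => ?_
    have ha := mdot_pair_fst m₁ m₂ s z
    have hb := mdot_pair_snd m₁ m₂ s z
    simp only [mul_sub, ite_mul, one_mul, zero_mul, mul_ite, mul_zero, Finset.sum_sub_distrib,
      Finset.sum_ite_eq, Finset.mem_univ, if_true]
    simp only [Fin.sum_univ_three, boostWedge, shellDot, mdot_eq, PiLp.add_apply,
      Fin.reduceSucc, Fin.succ_zero_eq_one, Fin.succ_one_eq_two] at ha hb ⊢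
    push_cast
    set w := pairPoint m₁ m₂ s z
    linear_combination (w.1 l.succ : ℂ) * ((w.1 0 : ℂ) + w.2 0) / 2 * (hb - ha)
  have h3 := (h'.mul_total hasTemperateGrowth_mdot).add
    (((isNull_firstMoment h1 h2 s 0).mul_total
      (((hasTemperateGrowth_coord l.succ).mul hκ).mul (.const (1 / 3)))).add
    ((isNull_firstMoment h1 h2 s l.succ).mul_total ((hasTemperateGrowth_coord 0).mul hκ)))
  refine h3.congr fun z => ?_
  have he : eta 0 l.succ = 0 := by simp [eta, (Fin.succ_ne_zero l).symm]
  simp only [firstMoment, secondMoment, he, Pi.mul_apply]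
  push_cast
  ring

lemma eta_succ_succ (l j : Fin 3) : eta l.succ j.succ = -(if l = j then 1 else 0) := by
  simp only [eta, Fin.succ_inj, Fin.succ_ne_zero, if_false]
  split_ifs <;> simp

lemma isNull_secondMoment_succ_succ (h1 : 0 ≤ m₁) (h2 : 0 ≤ m₂) (s : ℤˣ) (l j : Fin 3) :
    IsNull m₁ m₂ s (secondMoment m₁ m₂ l.succ j.succ) := by
  have hM := hasTemperateGrowth_mdot
  refine IsNull.of_mul_total (hasTemperateGrowth_secondMoment _ _ _ _)
    (w := fun k => k 0 ^ 2) ((hasTemperateGrowth_coord_real 0).pow 2)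
    (ae_energy_total_pos m₁ m₂ s) ?_
  have h := (((isNull_mul_boostWedge h1 h2 s l j).mul_total (hM.mul hM)).add
    (((isNull_secondMoment_zero_succ h1 h2 s l).mul_total (hasTemperateGrowth_coord j.succ)).add
    ((isNull_firstMoment h1 h2 s 0).mul_total ((hM.mul (hasTemperateGrowth_shellDot m₁ m₂)).mul
      (.const ((if l = j then 1 else 0) / 3)))))).mul_total (hasTemperateGrowth_coord 0)
  refine h.congr fun z => ?_
  have he : eta 0 l.succ = 0 := by simp [eta, (Fin.succ_ne_zero l).symm]
  simp only [boostWedge, firstMoment, secondMoment, he, eta_succ_succ, Pi.mul_apply, PiLp.add_apply]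
  split_ifs <;>
  · push_cast
    ring

lemma eta_comm (μ ν : Fin 4) : eta μ ν = eta ν μ := by
  rcases eq_or_ne μ ν with rfl | h
  · rfl
  · simp [eta, h, h.symm]

/-- The mean of `p^μ p^ν` at fixed total momentum `k` is spanned by `k^μ k^ν` and `η^{μν}`. -/
lemma isNull_secondMoment (h1 : 0 ≤ m₁) (h2 : 0 ≤ m₂) (s : ℤˣ) (μ ν : Fin 4) :
    IsNull m₁ m₂ s (secondMoment m₁ m₂ μ ν) := by
  refine Fin.cases ?_ (fun l => ?_) μ <;> refine Fin.cases ?_ (fun j => ?_) ν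
  · -- the trace is fixed by the mass shell
    have h := IsNull.sum Finset.univ fun l (_ : l ∈ Finset.univ) =>
      isNull_secondMoment_succ_succ h1 h2 s l l
    refine h.congr fun z => ?_
    have ha := mdot_pair_fst m₁ m₂ s z
    have hk := mdot_eq ((pairPoint m₁ m₂ s z).1 + (pairPoint m₁ m₂ s z).2)
      ((pairPoint m₁ m₂ s z).1 + (pairPoint m₁ m₂ s z).2)
    have he : eta 0 0 = 1 := by simp [eta]
    simp only [Fin.sum_univ_three, secondMoment, eta_succ_succ, he, if_true,
      Fin.reduceSucc, Fin.succ_zero_eq_one, Fin.succ_one_eq_two]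
    set w := pairPoint m₁ m₂ s z
    set M := mdot (w.1 + w.2) (w.1 + w.2)
    set κ := shellDot m₁ m₂ (w.1 + w.2)
    have hk' := congrArg Complex.ofReal hk
    push_cast at hk' ⊢
    linear_combination (-(M : ℂ) ^ 2) * ha + ((κ : ℂ) ^ 2 + 1 / 3 * (κ ^ 2 - M * m₁ ^ 2)) * (-hk')
  · exact isNull_secondMoment_zero_succ h1 h2 s j
  · refine (isNull_secondMoment_zero_succ h1 h2 s l).congr fun z => ?_
    simp only [secondMoment, eta_comm 0 l.succ]
    ring
  · exact isNull_secondMoment_succ_succ h1 h2 s l j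

end

section

/-! ### Amplitudes of the causal distributions -/

lemma isShellWave_deriv (m : ℝ) (μ : Fin 4) (s : ℤˣ) :
    IsShellWave m s (fun p => -Complex.I * (lower μ p : ℂ)) ((pauliJordan m).deriv μ s) := by
  have h := (isShellWave_pauliJordan m s).pd μ
  simp only [mul_one] at h
  exact h

lemma isShellWave_deriv_deriv (m : ℝ) (μ ν : Fin 4) (s : ℤˣ) :
    IsShellWave m s (fun p => -((lower μ p : ℂ) * (lower ν p : ℂ)))
      (((pauliJordan m).deriv ν).deriv μ s) := by
  have h := (isShellWave_deriv m ν s).pd μ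
  have e : (fun p => -Complex.I * (lower μ p : ℂ) * (-Complex.I * (lower ν p : ℂ))) =
      fun p => -((lower μ p : ℂ) * (lower ν p : ℂ)) := by
    funext p
    linear_combination (lower μ p : ℂ) * (lower ν p : ℂ) * Complex.I_sq
  rw [e] at h
  exact h

lemma isShellWave_derivUp (m : ℝ) (μ : Fin 4) (s : ℤˣ) :
    IsShellWave m s (fun p => -Complex.I * (p μ : ℂ)) ((pauliJordan m).derivUp μ s) := by
  have h := (isShellWave_deriv m μ s).smul (eta μ μ : ℂ)
  have e : (fun p : Mink => (eta μ μ : ℂ) * (-Complex.I * (lower μ p : ℂ))) =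
      fun p => -Complex.I * (p μ : ℂ) := by
    funext p
    have h2 : (eta μ μ : ℂ) * (eta μ μ : ℂ) = 1 := by exact_mod_cast eta_self_mul_self μ
    simp only [lower]
    push_cast
    linear_combination -Complex.I * (p μ : ℂ) * h2
  have e2 : (pauliJordan m).derivUp μ s = (eta μ μ : ℂ) • (pauliJordan m).deriv μ s := by
    refine Finset.sum_eq_single μ (fun ν _ hν => ?_) (by simp)
    rw [eta, if_neg hν.symm, Complex.ofReal_zero]
    exact zero_smul ℂ (pd ν (pauliJordan m s))
  rw [e] at h
  rw [e2]
  exact h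

variable (m₁ m₂ : ℝ)

lemma isPairWave_causal_pauliJordan :
    IsPairWave m₁ m₂ (fun _ => 1) (causal (pauliJordan m₁) (pauliJordan m₂)) :=
  (isPairWave_causal (isShellWave_pauliJordan m₁) (isShellWave_pauliJordan m₂)).congr
    (by simp only [mul_one])

lemma isPairWave_causal_deriv (μ : Fin 4) :
    IsPairWave m₁ m₂ (fun w => -Complex.I * (lower μ w.1 : ℂ))
      (causal ((pauliJordan m₁).deriv μ) (pauliJordan m₂)) :=
  (isPairWave_causal (isShellWave_deriv m₁ μ) (isShellWave_pauliJordan m₂)).congr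
    (by simp only [mul_one])

lemma isPairWave_causal_deriv_deriv (μ ν : Fin 4) :
    IsPairWave m₁ m₂ (fun w => -((lower μ w.2 : ℂ) * (lower ν w.2 : ℂ)))
      (causal (pauliJordan m₁) (((pauliJordan m₂).deriv ν).deriv μ)) :=
  (isPairWave_causal (isShellWave_pauliJordan m₁) (isShellWave_deriv_deriv m₂ μ ν)).congr
    (by simp only [one_mul])

lemma isPairWave_deriv_causal_deriv (μ ν : Fin 4) :
    IsPairWave m₁ m₂ (fun w => -((lower μ w.1 : ℂ) * (lower ν w.2 : ℂ)))
      (causal ((pauliJordan m₁).deriv μ) ((pauliJordan m₂).deriv ν)) :=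
  (isPairWave_causal (isShellWave_deriv m₁ μ) (isShellWave_deriv m₂ ν)).congr (by
    funext w
    linear_combination (lower μ w.1 : ℂ) * (lower ν w.2 : ℂ) * Complex.I_sq)

lemma isPairWave_sum_causal :
    IsPairWave m₁ m₂ (fun w => -(mdot w.1 w.2 : ℂ))
      (∑ μ, causal ((pauliJordan m₁).deriv μ) ((pauliJordan m₂).derivUp μ)) := by
  have h := fun μ => isPairWave_causal (isShellWave_deriv m₁ μ) (isShellWave_derivUp m₂ μ)
  rw [Fin.sum_univ_four]
  refine ((((h 0).add (h 1)).add (h 2)).add (h 3)).congr ?_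
  funext w
  simp only [lower, mdot_eq, eta, Fin.reduceEq, if_true, if_false]
  push_cast
  linear_combination ((w.1 0 : ℂ) * w.2 0 - w.1 1 * w.2 1 - w.1 2 * w.2 2 - w.1 3 * w.2 3)
    * Complex.I_sq

variable {m₁ m₂ : ℝ}

lemma isNull_firstMoment_lower (h1 : 0 ≤ m₁) (h2 : 0 ≤ m₂) (s : ℤˣ) (μ : Fin 4) :
    IsNull m₁ m₂ s fun w => (mdot (w.1 + w.2) (w.1 + w.2) : ℂ) * (lower μ w.1 : ℂ) -
      (shellDot m₁ m₂ (w.1 + w.2) : ℂ) * (lower μ (w.1 + w.2) : ℂ) := by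
  refine ((isNull_firstMoment h1 h2 s μ).const_mul (eta μ μ : ℂ)).congr fun z => ?_
  simp only [firstMoment, lower]
  push_cast
  ring

lemma isNull_secondMoment_lower (h1 : 0 ≤ m₁) (h2 : 0 ≤ m₂) (s : ℤˣ) (μ ν : Fin 4) :
    IsNull m₁ m₂ s fun w => (mdot (w.1 + w.2) (w.1 + w.2) : ℂ) ^ 2 *
        ((lower μ w.1 : ℂ) * (lower ν w.1 : ℂ)) -
      ((shellDot m₁ m₂ (w.1 + w.2) : ℂ) ^ 2 *
          ((lower μ (w.1 + w.2) : ℂ) * (lower ν (w.1 + w.2) : ℂ)) +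
        1 / 3 * ((lower μ (w.1 + w.2) : ℂ) * (lower ν (w.1 + w.2) : ℂ) -
          (eta μ ν : ℂ) * (mdot (w.1 + w.2) (w.1 + w.2) : ℂ)) *
        ((shellDot m₁ m₂ (w.1 + w.2) : ℂ) ^ 2 -
          (mdot (w.1 + w.2) (w.1 + w.2) : ℂ) * (m₁ : ℂ) ^ 2)) := by
  refine ((isNull_secondMoment h1 h2 s μ ν).const_mul ((eta μ μ : ℂ) * (eta ν ν : ℂ))).congr
    fun z => ?_
  have he : (eta μ μ : ℂ) * (eta ν ν : ℂ) * (eta μ ν : ℂ) = (eta μ ν : ℂ) := by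
    rcases eq_or_ne μ ν with rfl | h
    · have h2 : (eta μ μ : ℂ) * (eta μ μ : ℂ) = 1 := by exact_mod_cast eta_self_mul_self μ
      rw [h2, one_mul]
    · simp [eta, h]
  simp only [secondMoment, lower]
  set w := pairPoint m₁ m₂ s z
  set M := mdot (w.1 + w.2) (w.1 + w.2)
  set κ := shellDot m₁ m₂ (w.1 + w.2)
  push_cast
  linear_combination (M : ℂ) / 3 * ((κ : ℂ) ^ 2 - M * m₁ ^ 2) * he

/-! ### Massive particles: division by powers of `k²` -/

/-- A smooth version of `1 / k²`, exact for `k² ≥ (m₁ + m₂)² / 2`. -/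
def invSq (m₁ m₂ : ℝ) (k : Mink) : ℂ := (cutoffInv ((m₁ + m₂) ^ 2 / 2) (mdot k k) : ℂ)

lemma hasTemperateGrowth_invSq (h : 0 < m₁ + m₂) : (invSq m₁ m₂).HasTemperateGrowth :=
  hasTemperateGrowth_cutoffInv_comp (by positivity) hasTemperateGrowth_mdot_real

lemma mdot_total_pos (h : 0 < m₁ + m₂) (s : ℤˣ) (z : E3 × E3) :
    (m₁ + m₂) ^ 2 / 2 < mdot ((pairPoint m₁ m₂ s z).1 + (pairPoint m₁ m₂ s z).2)
      ((pairPoint m₁ m₂ s z).1 + (pairPoint m₁ m₂ s z).2) := by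
  have h1 := sq_add_le_mdot_total m₁ m₂ s z
  have h2 : 0 < (m₁ + m₂) ^ 2 := by positivity
  linarith

lemma invSq_mul_mdot (h : 0 < m₁ + m₂) {k : Mink} (hk : (m₁ + m₂) ^ 2 / 2 < mdot k k) :
    invSq m₁ m₂ k * (mdot k k : ℂ) = 1 := by
  have hc : 0 < (m₁ + m₂) ^ 2 / 2 := by positivity
  have h0 : mdot k k ≠ 0 := (hc.trans hk).ne'
  rw [invSq, cutoffInv_of_le hc hk.le, ← Complex.ofReal_mul, inv_mul_cancel₀ h0,
    Complex.ofReal_one]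

lemma exists_isDivKSq (h : 0 < m₁ + m₂) (n : ℕ) :
    ∃ w, IsDivKSq n (causal (pauliJordan m₁) (pauliJordan m₂)) w ∧
      IsPairWave m₁ m₂ (fun z => invSq m₁ m₂ (z.1 + z.2) ^ n) w := by
  have hd := isPairWave_causal_pauliJordan m₁ m₂
  have hχ : (fun k => invSq m₁ m₂ k ^ n).HasTemperateGrowth := (hasTemperateGrowth_invSq h).pow n
  obtain ⟨w, hw, hf⟩ := hd.exists_fourierM_eq_smulLeftCLM hχ
  refine ⟨w, ⟨{k | (m₁ + m₂) ^ 2 / 2 < mdot k k}, _, ?_, ?_, hχ, fun k hk => ?_, hf⟩,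
    hw.congr (by simp only [mul_one])⟩
  · exact isOpen_lt continuous_const (by simp only [mdot_eq]; fun_prop)
  · exact hd.isVanishingOn fun s z => mdot_total_pos h s z
  · rw [← mul_pow, invSq_mul_mdot h hk, one_pow]

lemma isPairWave_divKSq (h : 0 < m₁ + m₂) (n : ℕ) :
    IsPairWave m₁ m₂ (fun z => invSq m₁ m₂ (z.1 + z.2) ^ n)
      (divKSq n (causal (pauliJordan m₁) (pauliJordan m₂))) := by
  obtain ⟨w, hw, hp⟩ := exists_isDivKSq h n
  rwa [hw.divKSq_eq]

lemma isNull_lower (h1 : 0 ≤ m₁) (h2 : 0 ≤ m₂) (h : 0 < m₁ + m₂) (s : ℤˣ) (μ : Fin 4) :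
    IsNull m₁ m₂ s fun w => (lower μ w.1 : ℂ) - invSq m₁ m₂ (w.1 + w.2) *
      ((shellDot m₁ m₂ (w.1 + w.2) : ℂ) * (lower μ (w.1 + w.2) : ℂ)) := by
  refine ((isNull_firstMoment_lower h1 h2 s μ).mul_total (hasTemperateGrowth_invSq h)).congr
    fun z => ?_
  have hz := invSq_mul_mdot h (mdot_total_pos h s z)
  linear_combination (lower μ (pairPoint m₁ m₂ s z).1 : ℂ) * hz

lemma isNull_lower_mul_lower (h1 : 0 ≤ m₁) (h2 : 0 ≤ m₂) (h : 0 < m₁ + m₂) (s : ℤˣ)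
    (μ ν : Fin 4) :
    IsNull m₁ m₂ s fun w => (lower μ w.1 : ℂ) * (lower ν w.1 : ℂ) -
      (invSq m₁ m₂ (w.1 + w.2) ^ 2 * (shellDot m₁ m₂ (w.1 + w.2) : ℂ) ^ 2 *
          ((lower μ (w.1 + w.2) : ℂ) * (lower ν (w.1 + w.2) : ℂ)) +
        1 / 3 * ((lower μ (w.1 + w.2) : ℂ) * (lower ν (w.1 + w.2) : ℂ) -
          (eta μ ν : ℂ) * (mdot (w.1 + w.2) (w.1 + w.2) : ℂ)) *
        (invSq m₁ m₂ (w.1 + w.2) ^ 2 * (shellDot m₁ m₂ (w.1 + w.2) : ℂ) ^ 2 -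
          invSq m₁ m₂ (w.1 + w.2) * (m₁ : ℂ) ^ 2)) := by
  refine ((isNull_secondMoment_lower h1 h2 s μ ν).mul_total
    ((hasTemperateGrowth_invSq h).pow 2)).congr fun z => ?_
  have hz := invSq_mul_mdot h (mdot_total_pos h s z)
  simp only [Pi.pow_apply]
  set w := pairPoint m₁ m₂ s z
  set M := mdot (w.1 + w.2) (w.1 + w.2)
  set χ := invSq m₁ m₂ (w.1 + w.2)
  set p := (lower μ w.1 : ℂ) * (lower ν w.1 : ℂ)
  set K := (lower μ (w.1 + w.2) : ℂ) * (lower ν (w.1 + w.2) : ℂ)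
  linear_combination (p * (χ * M + 1) + 1 / 3 * (K - eta μ ν * M) * χ * m₁ ^ 2) * hz

/-! ### Massless particles -/

lemma isNull_lower_massless (s : ℤˣ) (μ : Fin 4) :
    IsNull 0 0 s fun w => (lower μ w.1 : ℂ) - 1 / 2 * (lower μ (w.1 + w.2) : ℂ) := by
  have hl := hasTemperateGrowth_lower μ
  refine IsNull.of_mul_total (w := fun k => mdot k k) ?_ hasTemperateGrowth_mdot_real
    (ae_mdot_total_pos s) ?_
  · exact (hl.comp (ContinuousLinearMap.fst ℝ Mink Mink).hasTemperateGrowth).sub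
      ((Function.HasTemperateGrowth.const _).mul (hasTemperateGrowth_total hl))
  · refine (isNull_firstMoment_lower le_rfl le_rfl s μ).congr fun z => ?_
    simp only [shellDot]
    push_cast
    ring

lemma isNull_lower_mul_lower_massless (s : ℤˣ) (μ ν : Fin 4) :
    IsNull 0 0 s fun w => (lower μ w.1 : ℂ) * (lower ν w.1 : ℂ) -
      (1 / 4 * ((lower μ (w.1 + w.2) : ℂ) * (lower ν (w.1 + w.2) : ℂ)) +
        1 / 12 * ((lower μ (w.1 + w.2) : ℂ) * (lower ν (w.1 + w.2) : ℂ) -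
          (eta μ ν : ℂ) * (mdot (w.1 + w.2) (w.1 + w.2) : ℂ))) := by
  have hl := hasTemperateGrowth_lower
  refine IsNull.of_mul_total (w := fun k => mdot k k ^ 2) ?_ (hasTemperateGrowth_mdot_real.pow 2)
    ((ae_mdot_total_pos s).mono fun z hz => pow_pos hz 2) ?_
  · have e1 := (hl μ).comp (ContinuousLinearMap.fst ℝ Mink Mink).hasTemperateGrowth
    have e2 := (hl ν).comp (ContinuousLinearMap.fst ℝ Mink Mink).hasTemperateGrowth
    have e3 := (hasTemperateGrowth_total (hl μ)).mul (hasTemperateGrowth_total (hl ν))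
    have e4 := hasTemperateGrowth_total hasTemperateGrowth_mdot
    exact (e1.mul e2).sub (((Function.HasTemperateGrowth.const _).mul e3).add
      ((Function.HasTemperateGrowth.const _).mul
        (e3.sub ((Function.HasTemperateGrowth.const _).mul e4))))
  · refine (isNull_secondMoment_lower le_rfl le_rfl s μ ν).congr fun z => ?_
    simp only [shellDot]
    push_cast
    ring

lemma lower_add (μ : Fin 4) (p q : Mink) : lower μ (p + q) = lower μ p + lower μ q := by
  simp only [lower, PiLp.add_apply, mul_add]

/-! ### The decompositions -/

lemma causal_deriv_eq (h1 : 0 ≤ m₁) (h2 : 0 ≤ m₂) (μ : Fin 4) :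
    causal ((pauliJordan m₁).deriv μ) (pauliJordan m₂) =
      (1 / 2 : ℂ) • pd μ (causal (pauliJordan m₁) (pauliJordan m₂) +
        ((m₁ : ℂ) ^ 2 - (m₂ : ℂ) ^ 2) • divKSq 1 (causal (pauliJordan m₁) (pauliJordan m₂))) := by
  have hd := isPairWave_causal_pauliJordan m₁ m₂
  have hL := isPairWave_causal_deriv m₁ m₂ μ
  rcases (add_nonneg h1 h2).eq_or_lt with h | h
  · obtain rfl : m₁ = 0 := by linarith
    obtain rfl : m₂ = 0 := by linarith
    have e : causal (pauliJordan 0) (pauliJordan 0) + (((0 : ℝ) : ℂ) ^ 2 - ((0 : ℝ) : ℂ) ^ 2) •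
        divKSq 1 (causal (pauliJordan 0) (pauliJordan 0)) =
        causal (pauliJordan 0) (pauliJordan 0) := by
      rw [Complex.ofReal_zero]; module
    rw [e]
    refine hL.eq_of_isNull ((hd.pd μ).smul _) fun s => ?_
    exact ((isNull_lower_massless s μ).const_mul (-Complex.I)).congr fun z => by ring
  · refine hL.eq_of_isNull (((hd.add ((isPairWave_divKSq h 1).smul _)).pd μ).smul _) fun s => ?_
    refine ((isNull_lower h1 h2 h s μ).const_mul (-Complex.I)).congr fun z => ?_
    have hz := invSq_mul_mdot h (mdot_total_pos h s z)
    simp only [shellDot]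
    push_cast
    set w := pairPoint m₁ m₂ s z
    linear_combination Complex.I / 2 * (lower μ (w.1 + w.2) : ℂ) * hz

lemma causal_deriv_deriv_eq (h1 : 0 ≤ m₁) (h2 : 0 ≤ m₂) {d d' d'' : TDist}
    (hd : d = causal (pauliJordan m₁) (pauliJordan m₂)) (hd' : d' = divKSq 1 d)
    (hd'' : d'' = divKSq 2 d) (μ ν : Fin 4) :
    causal (pauliJordan m₁) (((pauliJordan m₂).deriv ν).deriv μ) =
      (1 / 3 : ℂ) • transOp μ ν
        (d - (2 * (m₁ : ℂ) ^ 2 - (m₂ : ℂ) ^ 2) • d'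
          + ((m₁ : ℂ) ^ 2 - (m₂ : ℂ) ^ 2) ^ 2 • d'')
      + (1 / 4 : ℂ) • (eta μ ν : ℂ) •
        box (d - (2 * ((m₁ : ℂ) ^ 2 - (m₂ : ℂ) ^ 2)) • d'
          + ((m₁ : ℂ) ^ 2 - (m₂ : ℂ) ^ 2) ^ 2 • d'') := by
  have hp := isPairWave_causal_pauliJordan m₁ m₂
  rw [← hd] at hp
  have hL := isPairWave_causal_deriv_deriv m₁ m₂ μ ν
  have hlow := fun μ => hasTemperateGrowth_lower μ
  rcases (add_nonneg h1 h2).eq_or_lt with h | h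
  · obtain rfl : m₁ = 0 := by linarith
    obtain rfl : m₂ = 0 := by linarith
    have e1 : d - (2 * ((0 : ℝ) : ℂ) ^ 2 - ((0 : ℝ) : ℂ) ^ 2) • d'
        + (((0 : ℝ) : ℂ) ^ 2 - ((0 : ℝ) : ℂ) ^ 2) ^ 2 • d'' = d := by
      rw [Complex.ofReal_zero]; module
    have e2 : d - (2 * (((0 : ℝ) : ℂ) ^ 2 - ((0 : ℝ) : ℂ) ^ 2)) • d'
        + (((0 : ℝ) : ℂ) ^ 2 - ((0 : ℝ) : ℂ) ^ 2) ^ 2 • d'' = d := by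
      rw [Complex.ofReal_zero]; module
    rw [e1, e2]
    refine hL.eq_of_isNull (((hp.transOp μ ν).smul _).add ((hp.box.smul _).smul _)) fun s => ?_
    -- with `q = k - p`, the amplitude is reduced to moments of `p`
    refine ((((isNull_lower_massless s ν).mul_total (hlow μ)).add
      ((isNull_lower_massless s μ).mul_total (hlow ν))).sub
      (isNull_lower_mul_lower_massless s μ ν)).congr fun z => ?_
    simp only [lower_add]
    push_cast
    ring
  · have hp1 := isPairWave_divKSq h 1
    have hp2 := isPairWave_divKSq h 2
    rw [← hd, ← hd'] at hp1
    rw [← hd, ← hd''] at hp2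
    refine hL.eq_of_isNull (((((hp.sub (hp1.smul _)).add (hp2.smul _)).transOp μ ν).smul _).add
      (((((hp.sub (hp1.smul _)).add (hp2.smul _)).box).smul _).smul _)) fun s => ?_
    -- with `q = k - p`, the amplitude is reduced to moments of `p`
    refine ((((isNull_lower h1 h2 h s ν).mul_total (hlow μ)).add
      ((isNull_lower h1 h2 h s μ).mul_total (hlow ν))).sub
      (isNull_lower_mul_lower h1 h2 h s μ ν)).congr fun z => ?_
    have hz := invSq_mul_mdot h (mdot_total_pos h s z)
    have hM : ((mdot ((pairPoint m₁ m₂ s z).1 + (pairPoint m₁ m₂ s z).2)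
        ((pairPoint m₁ m₂ s z).1 + (pairPoint m₁ m₂ s z).2) : ℝ) : ℂ) ≠ 0 := by
      intro h0
      rw [h0, mul_zero] at hz
      exact zero_ne_one hz
    rw [← eq_div_iff hM] at hz
    simp only [hz, shellDot, lower_add]
    push_cast
    field_simp
    ring

lemma deriv_causal_deriv_eq (h1 : 0 ≤ m₁) (h2 : 0 ≤ m₂) {d d' d'' : TDist}
    (hd : d = causal (pauliJordan m₁) (pauliJordan m₂)) (hd' : d' = divKSq 1 d)
    (hd'' : d'' = divKSq 2 d) (μ ν : Fin 4) :
    causal ((pauliJordan m₁).deriv μ) ((pauliJordan m₂).deriv ν) =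
      (1 / 6 : ℂ) • transOp μ ν
        (d + ((m₁ : ℂ) ^ 2 + (m₂ : ℂ) ^ 2) • d'
          - (2 * ((m₁ : ℂ) ^ 2 - (m₂ : ℂ) ^ 2) ^ 2) • d'')
      + (1 / 4 : ℂ) • (eta μ ν : ℂ) •
        box (d - ((m₁ : ℂ) ^ 2 - (m₂ : ℂ) ^ 2) ^ 2 • d'') := by
  have hp := isPairWave_causal_pauliJordan m₁ m₂
  rw [← hd] at hp
  have hL := isPairWave_deriv_causal_deriv m₁ m₂ μ ν
  have hlow := fun μ => hasTemperateGrowth_lower μ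
  rcases (add_nonneg h1 h2).eq_or_lt with h | h
  · obtain rfl : m₁ = 0 := by linarith
    obtain rfl : m₂ = 0 := by linarith
    have e1 : d + (((0 : ℝ) : ℂ) ^ 2 + ((0 : ℝ) : ℂ) ^ 2) • d'
        - (2 * (((0 : ℝ) : ℂ) ^ 2 - ((0 : ℝ) : ℂ) ^ 2) ^ 2) • d'' = d := by
      rw [Complex.ofReal_zero]; module
    have e2 : d - (((0 : ℝ) : ℂ) ^ 2 - ((0 : ℝ) : ℂ) ^ 2) ^ 2 • d'' = d := by
      rw [Complex.ofReal_zero]; module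
    rw [e1, e2]
    refine hL.eq_of_isNull (((hp.transOp μ ν).smul _).add ((hp.box.smul _).smul _)) fun s => ?_
    -- with `q = k - p`, the amplitude is reduced to moments of `p`
    refine ((isNull_lower_mul_lower_massless s μ ν).sub
      ((isNull_lower_massless s μ).mul_total (hlow ν))).congr fun z => ?_
    simp only [lower_add]
    push_cast
    ring
  · have hp1 := isPairWave_divKSq h 1
    have hp2 := isPairWave_divKSq h 2
    rw [← hd, ← hd'] at hp1
    rw [← hd, ← hd''] at hp2
    refine hL.eq_of_isNull (((((hp.add (hp1.smul _)).sub (hp2.smul _)).transOp μ ν).smul _).add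
      ((((hp.sub (hp2.smul _)).box).smul _).smul _)) fun s => ?_
    -- with `q = k - p`, the amplitude is reduced to moments of `p`
    refine ((isNull_lower_mul_lower h1 h2 h s μ ν).sub
      ((isNull_lower h1 h2 h s μ).mul_total (hlow ν))).congr fun z => ?_
    have hz := invSq_mul_mdot h (mdot_total_pos h s z)
    have hM : ((mdot ((pairPoint m₁ m₂ s z).1 + (pairPoint m₁ m₂ s z).2)
        ((pairPoint m₁ m₂ s z).1 + (pairPoint m₁ m₂ s z).2) : ℝ) : ℂ) ≠ 0 := by
      intro h0
      rw [h0, mul_zero] at hz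
      exact zero_ne_one hz
    rw [← eq_div_iff hM] at hz
    simp only [hz, shellDot, lower_add]
    push_cast
    field_simp
    ring

lemma sum_causal_deriv_derivUp_eq (m₁ m₂ : ℝ) :
    ∑ μ, causal ((pauliJordan m₁).deriv μ) ((pauliJordan m₂).derivUp μ) =
      (1 / 2 : ℂ) • (box (causal (pauliJordan m₁) (pauliJordan m₂)) +
        ((m₁ : ℂ) ^ 2 + (m₂ : ℂ) ^ 2) • causal (pauliJordan m₁) (pauliJordan m₂)) := by
  have hp := isPairWave_causal_pauliJordan m₁ m₂
  refine (isPairWave_sum_causal m₁ m₂).eq_of_isNull ((hp.box.add (hp.smul _)).smul _) fun s => ?_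
  -- the amplitudes agree on the mass shells, where `k² = m₁² + m₂² + 2 p · q`
  refine (IsNull.sum (∅ : Finset ℕ) (F := fun _ _ => 0) (by simp)).congr fun z => ?_
  have ha := mdot_pair_fst m₁ m₂ s z
  have hb := mdot_pair_snd m₁ m₂ s z
  simp only [mdot_eq, PiLp.add_apply, Finset.sum_empty]
  push_cast
  linear_combination -(1 / 2 : ℂ) * (ha + hb)

end

end CausalDist

end

open CausalDist
theorem mainTheorem8
    (m₁ m₂ : ℝ) (hm₁ : 0 ≤ m₁) (hm₂ : 0 ≤ m₂)
    (D₁ D₂ : Split) (hD₁ : D₁ = pauliJordan m₁) (hD₂ : D₂ = pauliJordan m₂)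
    (d d' d'' : TDist) (hd : d = causal D₁ D₂) (hd' : d' = divKSq 1 d) (hd'' : d'' = divKSq 2 d) :
    -- all products of distributions that occur exist
    (HasCausal D₁ D₂ ∧ (∀ μ, HasCausal (D₁.deriv μ) D₂) ∧
      (∀ μ ν, HasCausal D₁ ((D₂.deriv ν).deriv μ)) ∧
      (∀ μ ν, HasCausal (D₁.deriv μ) (D₂.deriv ν)) ∧
      (∀ μ, HasCausal (D₁.deriv μ) (D₂.derivUp μ))) ∧
    -- `d'` and `d''` exist, unless both masses vanish (then they only occur with coefficient zero)
    (0 < m₁ + m₂ → HasDivKSq 1 d ∧ HasDivKSq 2 d) ∧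
    (∀ μ, causal (D₁.deriv μ) D₂ =
      (1 / 2 : ℂ) • pd μ (d + ((m₁ : ℂ) ^ 2 - (m₂ : ℂ) ^ 2) • d')) ∧
    (∀ μ ν, causal D₁ ((D₂.deriv ν).deriv μ) =
      (1 / 3 : ℂ) • transOp μ ν
        (d - (2 * (m₁ : ℂ) ^ 2 - (m₂ : ℂ) ^ 2) • d'
          + ((m₁ : ℂ) ^ 2 - (m₂ : ℂ) ^ 2) ^ 2 • d'')
      + (1 / 4 : ℂ) • (eta μ ν : ℂ) •
        box (d - (2 * ((m₁ : ℂ) ^ 2 - (m₂ : ℂ) ^ 2)) • d'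
          + ((m₁ : ℂ) ^ 2 - (m₂ : ℂ) ^ 2) ^ 2 • d'')) ∧
    (∀ μ ν, causal (D₁.deriv μ) (D₂.deriv ν) =
      (1 / 6 : ℂ) • transOp μ ν
        (d + ((m₁ : ℂ) ^ 2 + (m₂ : ℂ) ^ 2) • d'
          - (2 * ((m₁ : ℂ) ^ 2 - (m₂ : ℂ) ^ 2) ^ 2) • d'')
      + (1 / 4 : ℂ) • (eta μ ν : ℂ) •
        box (d - ((m₁ : ℂ) ^ 2 - (m₂ : ℂ) ^ 2) ^ 2 • d'')) ∧
    (∑ μ, causal (D₁.deriv μ) (D₂.derivUp μ) =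
      (1 / 2 : ℂ) • (box d + ((m₁ : ℂ) ^ 2 + (m₂ : ℂ) ^ 2) • d)) := by
  subst hD₁ hD₂
  refine ⟨⟨?_, fun μ => ?_, fun μ ν => ?_, fun μ ν => ?_, fun μ => ?_⟩, fun h => ?_, fun μ => ?_,
    causal_deriv_deriv_eq hm₁ hm₂ hd hd' hd'', deriv_causal_deriv_eq hm₁ hm₂ hd hd' hd'', ?_⟩
  · exact hasCausal_of_isShellWave (isShellWave_pauliJordan m₁) (isShellWave_pauliJordan m₂)
  · exact hasCausal_of_isShellWave (isShellWave_deriv m₁ μ) (isShellWave_pauliJordan m₂)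
  · exact hasCausal_of_isShellWave (isShellWave_pauliJordan m₁) (isShellWave_deriv_deriv m₂ μ ν)
  · exact hasCausal_of_isShellWave (isShellWave_deriv m₁ μ) (isShellWave_deriv m₂ ν)
  · exact hasCausal_of_isShellWave (isShellWave_deriv m₁ μ) (isShellWave_derivUp m₂ μ)
  · obtain ⟨w, hw, -⟩ := exists_isDivKSq h 1
    obtain ⟨w', hw', -⟩ := exists_isDivKSq h 2
    rw [hd]
    exact ⟨⟨w, hw⟩, ⟨w', hw'⟩⟩
  · rw [hd', hd]
    exact causal_deriv_eq hm₁ hm₂ μ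
  · rw [hd]
    exact sum_causal_deriv_derivUp_eq m₁ m₂
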